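/- Fix an embedding $\iota:\overline{\mathbb{Q}}\hookrightarrow\mathbb{C}$. A curve over an algebraically closed field is a smooth, irreducible, projective algebraic curve over it. A non-constant meromorphic (i.e. rational) function $f$ on a curve $X$ over $\mathbb{C}$ is the same as a non-constant morphism $f:X\to\mathbb{P}^1$; its degree is $\deg f=[\mathbb{C}(X):\mathbb{C}(f)]$, and its branch locus is the set of the values $f(x)\in\mathbb{P}^1(\mathbb{C})$ at the points $x$ of $X$ where $f$ has ramification index at least $2$. A Belyi function on $X$ is a non-constant meromorphic function on $X$ whose branch locus is contained in $\{0,1,\infty\}$. The curve $X$ is defined over $\overline{\mathbb{Q}}$ if it is the base change along $\iota$ of a curve $X_0$ over $\overline{\mathbb{Q}}$ (a model of $X$), and a meromorphic function on $X$ is then defined over $\overline{\mathbb{Q}}$ (with respect to this model) if it is the pullback of a rational function on $X_0$. Theorem. Let $X$ be a curve over $\mathbb{C}$ that is defined over $\overline{\mathbb{Q}}$, with model $X_0$. If $X$ admits a non-constant meromorphic function of odd degree that is defined over $\overline{\mathbb{Q}}$, then $X$ admits a Belyi function of odd degree, and this Belyi function can be taken to be defined over $\overline{\mathbb{Q}}$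 as well (with respect to the same model). -/

import Mathlib

open CategoryTheory AlgebraicGeometry

noncomputable section

attribute [local instance] MvPolynomial.gradedAlgebra

/-- Projective `n`-space over the field `k`, as `Proj k[X₀, …, Xₙ]`. -/
abbrev ProjectiveNSpace (k : Type) [Field k] (n : ℕ) : Scheme.{0} :=
  Proj (MvPolynomial.homogeneousSubmodule (Fin (n + 1)) k)

/-- The structure morphism of projective `n`-space over `k`. -/
def ProjectiveNSpace.toSpec (k : Type) [Field k] (n : ℕ) :
    ProjectiveNSpace k n ⟶ Spec (.of k) :=
  Proj.toSpecZero (MvPolynomial.homogeneousSubmodule (Fin (n + 1)) k) ≫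
    Spec.map (CommRingCat.ofHom
      (algebraMap k (MvPolynomial.homogeneousSubmodule (Fin (n + 1)) k 0)))

/-- A curve over a field `k` (used below only for algebraically closed `k`): an integral scheme
with a structure morphism to `Spec k` that is smooth of relative dimension `1` and factors
through a closed immersion into some projective space over `k`. -/
structure SmoothProjectiveCurve (k : Type) [Field k] where
  /-- The underlying scheme. -/
  carrier : Scheme.{0}
  /-- The structure morphism. -/
  str : carrier ⟶ Spec (.of k)
  isIntegral : IsIntegral carrier
  smooth : SmoothOfRelativeDimension 1 str
  projective : ∃ (n : ℕ) (i : carrier ⟶ ProjectiveNSpace k n),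
    IsClosedImmersion i ∧ i ≫ ProjectiveNSpace.toSpec k n = str

namespace SmoothProjectiveCurve

attribute [instance] SmoothProjectiveCurve.isIntegral SmoothProjectiveCurve.smooth

variable {k : Type} [Field k] (X : SmoothProjectiveCurve k)

/-- The field of meromorphic (that is, rational) functions on `X`. -/
abbrev Mero : Type := X.carrier.functionField

/-- The inclusion of the constants into the meromorphic functions. -/
def const : k →+* X.Mero :=
  (X.carrier.presheaf.germ ⊤ (genericPoint X.carrier) trivial).hom.comp
    (X.str.appTop.hom.comp (Scheme.ΓSpecIso (.of k)).inv.hom)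

instance : Algebra k X.Mero := X.const.toAlgebra

variable {X}

/-- `f` is non-constant. -/
def IsNonconstant (f : X.Mero) : Prop := ∀ c : k, f ≠ algebraMap k X.Mero c

/-- The degree of the non-constant function `f`, that is, of the morphism `f : X → ℙ¹`:
the degree `[k(X) : k(f)]` of the extension of function fields. -/
def degree (f : X.Mero) : ℕ :=
  Module.finrank (IntermediateField.adjoin k {f}) X.Mero

/-- `g` vanishes at the point `x` to order at least `2`: it lies in `𝔪ₓ²`, where `𝔪ₓ` is the
maximal ideal of the local ring `𝒪_{X,x}`, viewed inside the function field. -/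
def VanishesDoublyAt (g : X.Mero) (x : X.carrier) : Prop :=
  ∃ a ∈ (IsLocalRing.maximalIdeal (X.carrier.presheaf.stalk x)) ^ 2,
    algebraMap (X.carrier.presheaf.stalk x) X.Mero a = g

/-- The branch locus in `ℙ¹(k) = k ∪ {∞}` of `f : X → ℙ¹` (for `f` non-constant): the set of the
values of `f` at those closed points of `X` where `f` has ramification index at least `2`.
A finite value `c` belongs to it if `f - c` has a zero of order at least `2` somewhere, and `∞`
belongs to it if `1 / f` has a zero of order at least `2` somewhere. -/
def branchLocus (f : X.Mero) : Set (OnePoint k) :=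
  {p | ∃ x : X.carrier, IsClosed {x} ∧
    ((∃ c : k, p = (c : OnePoint k) ∧ VanishesDoublyAt (f - algebraMap k X.Mero c) x) ∨
      (p = OnePoint.infty ∧ VanishesDoublyAt f⁻¹ x))}

/-- A Belyi function: a non-constant meromorphic function that is unbranched
outside `{0, 1, ∞}`. -/
def IsBelyi (f : X.Mero) : Prop :=
  IsNonconstant f ∧
    branchLocus f ⊆ {((0 : k) : OnePoint k), ((1 : k) : OnePoint k), OnePoint.infty}

variable {k₀ : Type} [Field k₀]

/-- `π : X → X₀` presents the curve `X` over `k` as the base change, along `ι : k₀ → k`, of the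
curve `X₀` over `k₀`; thus `X` is defined over `k₀`, with model `X₀`. -/
def IsModel (ι : k₀ →+* k) (X : SmoothProjectiveCurve k) (X₀ : SmoothProjectiveCurve k₀)
    (π : X.carrier ⟶ X₀.carrier) : Prop :=
  IsPullback π X.str X₀.str (Spec.map (CommRingCat.ofHom ι))

/-- The meromorphic function `f` on `X` is the pullback along `π : X → X₀` of a meromorphic
function on `X₀`, given by a regular function `s` on an open set `U` whose preimage is
non-empty. If `π` presents `X₀` as a model of `X` over `k₀`, this says that `f` is defined
over `k₀`. -/
def IsPullbackFunction {X₀ : SmoothProjectiveCurve k₀} (π : X.carrier ⟶ X₀.carrier)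
    (f : X.Mero) : Prop :=
  ∃ (U : X₀.carrier.Opens) (_ : Nonempty (π ⁻¹ᵁ U)) (s : Γ(X₀.carrier, U)),
    X.carrier.germToFunctionField (π ⁻¹ᵁ U) (π.app U s) = f

end SmoothProjectiveCurve

end

/-!
Let `f` be the given function of odd degree on `X`, defined over the field `ℚ̄` of algebraic
numbers. A Belyi function is obtained as `φ = R(P(f))`, where `P` is a polynomial and `R = A / B`
a rational function, both of odd degree and with algebraic coefficients. Since the degree of a
composite is the product of the degrees (`finrank_adjoin_div`) and functions defined over `ℚ̄` are
closed under such compositions, only the branch locus has to be controlled. The finite branch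
points of a composite are values at branch points of the inner function or at critical points of
the outer one (`exists_of_aeval_sub_mem_sq`, `exists_of_div_sub_mem_sq`), and they behave as
follows.

* The finite branch points of `f` are algebraic. Over `ℂ(f)`, the function field of `X` is
  generated by one function `θ` that is algebraic over `ℚ̄(f)` (`exists_adjoin_pair_eq_top`). Let
  `P(f, θ) = 0` be a separable relation over `ℚ̄`. Then `f` is unramified at all points where
  `θ` is regular and `∂P/∂Y (f, θ)` does not vanish (`sub_algebraMap_notMem_sq`), and the values of
  `f` at the other points are infinite or roots of a polynomial over `ℚ̄`
  (`exists_aeval_eq_zero_of_branch_value`).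

* There is a polynomial of odd degree that maps these branch points and its own critical points
  into `ℚ` (`exists_odd_natDegree_rational_values`). As in Belyi's argument, this is an induction on
  the degree of a rational polynomial `h` that vanishes at the points in question: `h` maps them to
  `0`, and its critical values are roots of a polynomial of smaller degree. If `deg h` is even, then
  `h` is replaced by `(X - a) h`, with `a` chosen such that one of the critical points is rational.
  After scaling, the values are integers.

* A finite set of integers is moved into `{0, 1, ∞}` by one rational function
  `R = ∏ (X - s) ^ n s`, where `s` runs through a finite set `T` of integers that contains the given
  ones. If `n s` is proportional to `1 / ∏ t ≠ s, (s - t)`, then, by partial fractions, the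
  logarithmic derivative of `R` is a constant multiple of `1 / ∏ (X - s)`. So the critical points
  of `R` are among its zeros, its poles and `∞`, where its value is `1`
  (`exists_fraction_of_odd_degree`). The degree of `R` is the sum of the positive `n s`, and it
  becomes odd when a point that is `2`-adically very close to the largest given integer is added
  to the given ones (`exists_superset_exponents`).

The local ring at a point where a nonzero function vanishes doubly is a discrete valuation ring with
residue field `ℂ`: as the module of differentials is locally free of rank one, the maximal ideal is
principal (`localization_of_isStandardSmooth`).
-/

noncomputable section

/-! ### Polynomials of odd degree that make finitely many algebraic numbers rational -/

section RationalCriticalValues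

open Polynomial

variable {K : Type*} [Field K] [Algebra ℚ K]

/-- The values of `P` at the roots of `R` are the roots of a rational polynomial of degree at most
`deg R`, namely the minimal polynomial of the class of `P` modulo `R`. -/
theorem exists_aeval_aeval_eq_zero {R : ℚ[X]} (hR : R ≠ 0) (P : ℚ[X]) :
    ∃ h : ℚ[X], h ≠ 0 ∧ h.natDegree ≤ R.natDegree ∧
      ∀ b : K, aeval b R = 0 → aeval (aeval b P) h = 0 := by
  have := (AdjoinRoot.powerBasis hR).finite
  have hint : IsIntegral ℚ (AdjoinRoot.mk R P) := Algebra.IsIntegral.isIntegral _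
  refine ⟨minpoly ℚ (AdjoinRoot.mk R P), minpoly.ne_zero hint, ?_, fun b hb ↦ ?_⟩
  · refine (minpoly.natDegree_le _).trans_eq ?_
    rw [(AdjoinRoot.powerBasis hR).finrank, AdjoinRoot.powerBasis_dim]
  · have h0 : AdjoinRoot.mk R ((minpoly ℚ (AdjoinRoot.mk R P)).comp P) = 0 := by
      rw [← AdjoinRoot.aeval_eq, aeval_comp, AdjoinRoot.aeval_eq, minpoly.aeval]
    obtain ⟨T, hT⟩ := AdjoinRoot.mk_eq_zero.mp h0
    rw [← aeval_comp, hT, map_mul, hb, zero_mul]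

/-- A rational polynomial `P` of odd degree, vanishing at all roots of `h`, whose critical points
are rational or roots of a polynomial of degree less than `deg h`. If `deg h` is odd, then `P = h`
will do. If it is even, then `P = (X - a) h` has odd degree, and `a` is chosen such that the
derivative of `P` has a rational root, which splits off. -/
theorem exists_odd_natDegree_and_derivative_roots {h : ℚ[X]} (hh : h.natDegree ≠ 0) :
    ∃ P R : ℚ[X], Odd P.natDegree ∧ R ≠ 0 ∧ R.natDegree < h.natDegree ∧ h ∣ P ∧
      ∀ b : K, aeval b (derivative P) = 0 → aeval b R = 0 ∨ b ∈ Set.range (algebraMap ℚ K) := by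
  have h0 : h ≠ 0 := by rintro rfl; simp at hh
  have hd : derivative h ≠ 0 := fun H ↦ hh (derivative_eq_zero.mp H)
  rcases Nat.even_or_odd h.natDegree with he | ho
  · obtain ⟨r, hr⟩ : ∃ r, (derivative h).eval r ≠ 0 := by
      by_contra! H
      exact hd (Polynomial.funext (by simpa using H))
    -- the root `r` of the derivative of `(X - a) h` forces this value of `a`
    set a : ℚ := r + h.eval r / (derivative h).eval r with ha
    set P : ℚ[X] := (X - C a) * h with hP
    have hPd : P.natDegree = h.natDegree + 1 := by
      rw [hP, natDegree_mul (X_sub_C_ne_zero a) h0, natDegree_X_sub_C, add_comm]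
    have hroot : (derivative P).IsRoot r := by
      simp only [hP, derivative_mul, IsRoot, eval_add, eval_mul, derivative_sub, derivative_X,
        derivative_C, eval_sub, eval_one, eval_zero, eval_X, eval_C, ha]
      field_simp
      ring
    obtain ⟨R, hR⟩ := dvd_iff_isRoot.mpr hroot
    have hdeg : (derivative P).natDegree = h.natDegree := by
      rw [natDegree_derivative, hPd, Nat.add_sub_cancel]
    have hR0 : R ≠ 0 := by
      rintro rfl
      rw [hR] at hdeg
      simp at hdeg
      exact hh hdeg.symm
    refine ⟨P, R, by rw [hPd]; exact he.add_one, hR0, ?_, dvd_mul_left _ _, fun b hb ↦ ?_⟩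
    · rw [hR, natDegree_mul (X_sub_C_ne_zero r) hR0, natDegree_X_sub_C] at hdeg
      omega
    · rw [hR, map_mul, mul_eq_zero] at hb
      rcases hb with hb | hb
      · right
        refine ⟨r, ?_⟩
        simpa using (sub_eq_zero.mp (by simpa using hb)).symm
      · exact .inl hb
  · exact ⟨h, derivative h, ho, hd, natDegree_derivative_lt hh, dvd_rfl, fun b hb ↦ .inl hb⟩

/-- For every finite set of algebraic numbers, given as the roots of `h`, there is a polynomial of
odd degree with rational values at these numbers and rational critical values. -/
theorem exists_odd_natDegree_rational_values (h : ℚ[X]) (h0 : h ≠ 0) :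
    ∃ P : ℚ[X], Odd P.natDegree ∧
      (∀ b : K, aeval b h = 0 → aeval b P ∈ Set.range (algebraMap ℚ K)) ∧
      ∀ b : K, aeval b (derivative P) = 0 → aeval b P ∈ Set.range (algebraMap ℚ K) := by
  induction hn : h.natDegree using Nat.strong_induction_on generalizing h with
  | _ n ih =>
  subst hn
  by_cases hh : h.natDegree = 0
  · rw [eq_C_of_natDegree_eq_zero hh] at h0 ⊢
    refine ⟨X, by simp, fun b hb ↦ ?_, fun b hb ↦ by simp at hb⟩
    rw [aeval_C, map_eq_zero] at hb
    exact absurd (by rw [hb, C_0]) h0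
  obtain ⟨P₁, R, hodd, hR, hlt, ⟨T, hT⟩, hcrit⟩ :=
    exists_odd_natDegree_and_derivative_roots (K := K) hh
  obtain ⟨g, hg, hgd, hgr⟩ := exists_aeval_aeval_eq_zero (K := K) hR P₁
  obtain ⟨P₂, hodd₂, hroot₂, hcrit₂⟩ := ih _ (hgd.trans_lt hlt) g hg rfl
  have hrat (Q : ℚ[X]) (q : ℚ) : aeval (algebraMap ℚ K q) Q ∈ Set.range (algebraMap ℚ K) :=
    ⟨Q.eval q, by rw [aeval_algebraMap_apply, coe_aeval_eq_eval]⟩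
  refine ⟨P₂.comp P₁, by rw [natDegree_comp]; exact hodd₂.mul hodd, fun b hb ↦ ?_, fun b hb ↦ ?_⟩
  · rw [aeval_comp, hT, map_mul, hb, zero_mul]
    simpa using hrat P₂ 0
  · rw [derivative_comp, map_mul, mul_eq_zero, aeval_comp] at hb
    rw [aeval_comp]
    rcases hb with hb | hb
    · rcases hcrit b hb with hb | ⟨q, rfl⟩
      · exact hroot₂ _ (hgr b hb)
      · obtain ⟨q', hq'⟩ := hrat P₁ q
        rw [← hq']
        exact hrat P₂ q'
    · exact hcrit₂ _ hb

end RationalCriticalValues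

section IntegerValues

open Polynomial

/-- For every finite set of algebraic numbers there is a polynomial of odd degree with integer
values at these numbers and integer critical values. -/
theorem exists_odd_natDegree_integer_values {K : Type*} [Field K] [Algebra ℚ K]
    [Algebra.IsAlgebraic ℚ K] {D : K[X]} (hD : D ≠ 0) :
    ∃ (P : K[X]) (S : Finset ℤ), Odd P.natDegree ∧ S.Nonempty ∧
      ∀ b : K, D.eval b = 0 ∨ (derivative P).eval b = 0 → ∃ s ∈ S, P.eval b = (s : K) := by
  classical
  have : CharZero K := charZero_of_injective_algebraMap (algebraMap ℚ K).injective
  have hint (z : K) : IsIntegral ℚ z := Algebra.IsIntegral.isIntegral z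
  obtain ⟨P, hodd, hroot, hcrit⟩ := exists_odd_natDegree_rational_values (K := K)
    (∏ z ∈ D.roots.toFinset, minpoly ℚ z)
    (Finset.prod_ne_zero_iff.mpr fun z _ ↦ minpoly.ne_zero (hint z))
  set P₁ : K[X] := P.map (algebraMap ℚ K) with hP₁
  have hdeg : P₁.natDegree = P.natDegree := natDegree_map _
  have hP₁d : derivative P₁ ≠ 0 := by
    intro h
    have := derivative_eq_zero.mp h
    rw [hdeg] at this
    simp [this] at hodd
  set Z : Finset K := D.roots.toFinset ∪ (derivative P₁).roots.toFinset with hZ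
  have hval : ∀ z ∈ Z, ∃ q : ℚ, algebraMap ℚ K q = P₁.eval z := by
    intro z hz
    rw [eval_map_algebraMap]
    rcases Finset.mem_union.mp hz with hz | hz
    · refine hroot z ?_
      rw [map_prod, Finset.prod_eq_zero hz (minpoly.aeval ℚ z)]
    · refine hcrit z ?_
      rw [← eval_map_algebraMap, ← derivative_map]
      exact (mem_roots'.mp (Multiset.mem_toFinset.mp hz)).2
  choose! q hq using hval
  -- a common denominator of the rational values
  set N : ℕ := ∏ z ∈ Z, (q z).den with hN
  have hN0 : (N : K) ≠ 0 := by
    exact_mod_cast Finset.prod_ne_zero_iff.mpr fun z _ ↦ (q z).den_ne_zero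
  have hNq : ∀ z ∈ Z, ∃ s : ℤ, (N : K) * P₁.eval z = s := by
    intro z hz
    refine ⟨(∏ y ∈ Z.erase z, ((q y).den : ℤ)) * (q z).num, ?_⟩
    have h1 : ((q z).den : ℚ) * q z = (q z).num := Rat.den_mul_eq_num _
    rw [← hq z hz, hN, ← Finset.mul_prod_erase Z _ hz]
    have h2 := congrArg (algebraMap ℚ K) h1
    simp only [map_mul, map_natCast, map_intCast] at h2
    push_cast
    rw [← h2]
    ring
  choose! s hs using hNq
  refine ⟨C (N : K) * P₁, insert 0 (Z.image s), ?_, Finset.insert_nonempty _ _, fun b hb ↦ ?_⟩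
  · rw [natDegree_C_mul hN0, hdeg]
    exact hodd
  · have hbZ : b ∈ Z := by
      rw [hZ, Finset.mem_union, Multiset.mem_toFinset, Multiset.mem_toFinset, mem_roots hD,
        mem_roots hP₁d]
      refine hb.imp_right fun h ↦ ?_
      rw [derivative_C_mul, eval_mul, eval_C] at h
      exact (mul_eq_zero.mp h).resolve_left hN0
    exact ⟨s b, Finset.mem_insert_of_mem (Finset.mem_image_of_mem s hbZ), by
      rw [eval_mul, eval_C, hs b hbZ]⟩

end IntegerValues

/-! ### Exponents for a product of linear factors with few critical points -/

section Exponents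

/-- `x` is `2 ^ e` times an odd number. -/
def HasTwoVal (x : ℤ) (e : ℕ) : Prop := ∃ o, Odd o ∧ x = 2 ^ e * o

theorem HasTwoVal.exists {x : ℤ} (hx : x ≠ 0) : ∃ e, HasTwoVal x e := by
  obtain ⟨o, h, ho⟩ := (Int.finiteMultiplicity_iff.mpr
    ⟨by decide, hx⟩ : FiniteMultiplicity 2 x).exists_eq_pow_mul_and_not_dvd
  exact ⟨_, o, Int.not_even_iff_odd.mp (mt even_iff_two_dvd.mp ho), h⟩

theorem HasTwoVal.mul {x y : ℤ} {e f : ℕ} (hx : HasTwoVal x e) (hy : HasTwoVal y f) :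
    HasTwoVal (x * y) (e + f) := by
  obtain ⟨o, ho, rfl⟩ := hx
  obtain ⟨o', ho', rfl⟩ := hy
  exact ⟨o * o', ho.mul ho', by ring⟩

theorem HasTwoVal.neg {x : ℤ} {e : ℕ} (hx : HasTwoVal x e) : HasTwoVal (-x) e := by
  obtain ⟨o, ho, rfl⟩ := hx
  exact ⟨-o, ho.neg, by ring⟩

theorem HasTwoVal.prod {ι : Type*} {s : Finset ι} {f : ι → ℤ} {e : ι → ℕ}
    (h : ∀ i ∈ s, HasTwoVal (f i) (e i)) : HasTwoVal (∏ i ∈ s, f i) (∑ i ∈ s, e i) := by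
  classical
  induction s using Finset.induction_on with
  | empty => exact ⟨1, odd_one, by simp⟩
  | insert a s ha ih =>
    rw [Finset.prod_insert ha, Finset.sum_insert ha]
    exact (h a (by simp)).mul (ih fun i hi ↦ h i (by simp [hi]))

theorem HasTwoVal.add_two_pow {x : ℤ} {e K : ℕ} (hx : HasTwoVal x e) (h : e < K) :
    HasTwoVal (x + 2 ^ K) e := by
  obtain ⟨o, ho, rfl⟩ := hx
  obtain ⟨j, rfl⟩ := Nat.exists_eq_add_of_lt h
  exact ⟨o + 2 ^ (j + 1), ho.add_even ((even_two).pow_of_ne_zero (by simp)), by ring⟩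

/-- Every finite nonempty set `S` of integers is contained in a finite set `T` of integers such
that, after multiplication with a common constant, the numbers `1 / ∏ t ≠ s, (s - t)` for `s ∈ T`
are integers `n s` and the sum of the positive ones is odd.

To obtain `T`, a point `p` is added that is `2`-adically close to the largest element `M` of `S`
and lies above it. By closeness `n p` and `n M` have the same `2`-adic valuation, which is less
than that of all others; so these two numbers can be made odd and the others even. As `p` and `M`
are neighbours in `T`, the signs of `n p` and `n M` differ, and exactly one of them is counted. -/
theorem exists_superset_exponents (S : Finset ℤ) (hS : S.Nonempty) :
    ∃ (T : Finset ℤ) (n : ℤ → ℤ) (W : ℤ), S ⊆ T ∧ 2 ≤ T.card ∧ W ≠ 0 ∧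
      (∀ s ∈ T, n s * ∏ t ∈ T.erase s, (s - t) = W) ∧ Odd (∑ s ∈ T, (n s).toNat) := by
  classical
  have hv : ∀ d : ℤ, ∃ e, d ≠ 0 → HasTwoVal d e := fun d ↦ by
    by_cases hd : d = 0
    · exact ⟨0, fun h ↦ absurd hd h⟩
    · obtain ⟨e, he⟩ := HasTwoVal.exists hd
      exact ⟨e, fun _ ↦ he⟩
  choose v hv using hv
  set M := S.max' hS with hM
  have hMS : M ∈ S := S.max'_mem hS
  set C : ℕ := ∑ s ∈ S, ∑ t ∈ S, (v (s - t)) with hC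
  have hle (s) (hs : s ∈ S) (U) (hU : U ⊆ S) : ∑ t ∈ U, v (s - t) ≤ C :=
    (Finset.sum_le_sum_of_subset hU).trans
      (Finset.single_le_sum (f := fun s ↦ ∑ t ∈ S, v (s - t)) (fun _ _ ↦ Nat.zero_le _) hs)
  have hle' (s) (hs : s ∈ S) (t) (ht : t ∈ S) : v (s - t) ≤ C := by
    simpa using hle s hs {t} (by simpa using ht)
  set K : ℕ := 2 * C + 1 with hK
  set p : ℤ := M + 2 ^ K with hp
  have hSp : ∀ t ∈ S, t < p := fun t ht ↦
    (S.le_max' t ht).trans_lt (by rw [hp, ← hM]; linarith [pow_pos (two_pos (α := ℤ)) K])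
  have hpS : p ∉ S := fun h ↦ lt_irrefl _ (hSp p h)
  have hpM : p ≠ M := fun h ↦ hpS (h ▸ hMS)
  set T := insert p S with hT
  set w : ℤ → ℤ := fun s ↦ ∏ t ∈ T.erase s, (s - t) with hw
  have hwp : w p = ∏ t ∈ S, (p - t) := by simp only [hw, hT, Finset.erase_insert hpS]
  have hws (s) (hs : s ∈ S) : w s = (s - p) * ∏ t ∈ S.erase s, (s - t) := by
    have h : T.erase s = insert p (S.erase s) :=
      Finset.erase_insert_of_ne (fun h ↦ hpS (h ▸ hs))
    simp only [hw]
    rw [h, Finset.prod_insert (fun h ↦ hpS (Finset.mem_of_mem_erase h))]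
  -- the sum of the valuations of the differences between `M` and the other elements of `S`
  set E := ∑ t ∈ S.erase M, v (M - t) with hE
  set e : ℤ → ℕ := fun s ↦ if s = p ∨ s = M then K + E else
    v (M - s) + ∑ t ∈ S.erase s, v (s - t) with he
  have hsub {s t : ℤ} (U : Finset ℤ) (ht : t ∈ U.erase s) : s - t ≠ 0 :=
    sub_ne_zero.mpr (Finset.ne_of_mem_erase ht).symm
  have h2K : HasTwoVal (2 ^ K) K := ⟨1, odd_one, by simp⟩
  have hval : ∀ s ∈ T, HasTwoVal (w s) (e s) := by
    intro s hs
    rcases Finset.mem_insert.mp hs with rfl | hs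
    · simp only [he, true_or, if_true, hwp]
      rw [← Finset.mul_prod_erase S _ hMS]
      refine HasTwoVal.mul (by simpa [hp] using h2K) (HasTwoVal.prod fun t ht ↦ ?_)
      rw [hp, show M + 2 ^ K - t = M - t + 2 ^ K by ring]
      refine (hv _ (hsub S ht)).add_two_pow ?_
      have := hle' M hMS t (Finset.mem_of_mem_erase ht)
      omega
    · have hprod : HasTwoVal (∏ t ∈ S.erase s, (s - t)) (∑ t ∈ S.erase s, v (s - t)) :=
        HasTwoVal.prod fun t ht ↦ hv _ (hsub S ht)
      rw [hws s hs]
      by_cases hsM : s = M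
      · subst hsM
        simp only [he, or_true, if_true]
        exact HasTwoVal.mul (by simpa [hp] using h2K.neg) hprod
      · have hsp : s ≠ p := fun h ↦ hpS (h ▸ hs)
        simp only [he, hsM, hsp, or_self, if_false]
        refine HasTwoVal.mul ?_ hprod
        rw [show s - p = -(M - s + 2 ^ K) by rw [hp]; ring]
        refine ((hv _ (sub_ne_zero.mpr (Ne.symm hsM))).add_two_pow ?_).neg
        have := hle' M hMS s hs
        omega
  have heM : e M = K + E := by simp [he]
  have hep : e p = K + E := by simp [he]
  have hes : ∀ s ∈ S.erase M, e s < K + E := by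
    intro s hs
    have hsS := Finset.mem_of_mem_erase hs
    have hsp : s ≠ p := fun h ↦ hpS (h ▸ hsS)
    simp only [he, Finset.ne_of_mem_erase hs, hsp, or_self, if_false]
    have h1 := hle' M hMS s hsS
    have h2 := hle s hsS _ (S.erase_subset s)
    omega
  have heT : ∀ s ∈ T, e s ≤ K + E := by
    intro s hs
    rcases Finset.mem_insert.mp hs with rfl | hs
    · exact hep.le
    · by_cases h : s = M
      · rw [h, heM]
      · exact (hes s (Finset.mem_erase.mpr ⟨h, hs⟩)).le
  choose! o ho hwo using hval
  have hodd (U : Finset ℤ) (hU : U ⊆ T) : Odd (∏ t ∈ U, o t) := by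
    rw [Int.odd_iff, Finset.prod_int_mod, Finset.prod_congr rfl
      (fun t ht ↦ Int.odd_iff.mp (ho t (hU ht)))]
    simp
  set n : ℤ → ℤ := fun s ↦ 2 ^ (K + E - e s) * ∏ t ∈ T.erase s, o t with hn
  set W : ℤ := 2 ^ (K + E) * ∏ t ∈ T, o t with hW
  have hW0 : W ≠ 0 := mul_ne_zero (by positivity) (fun h ↦ by simpa [h] using hodd T subset_rfl)
  have hnw : ∀ s ∈ T, n s * w s = W := by
    intro s hs
    rw [hwo s hs, hW, ← Finset.mul_prod_erase T _ hs]
    conv_rhs => rw [← Nat.sub_add_cancel (heT s hs), pow_add]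
    simp only [hn]
    ring
  have hpT : p ∈ T := Finset.mem_insert_self _ _
  have hMT : M ∈ T := Finset.mem_insert_of_mem hMS
  have hnodd (s) (hs : e s = K + E) : Odd (n s) := by
    simp only [hn, hs, Nat.sub_self, pow_zero, one_mul]
    exact hodd _ (T.erase_subset s)
  have hneven (s) (hs : s ∈ S.erase M) : Even (n s).toNat := by
    have : Even (n s) := by
      simp only [hn]
      exact ((even_two).pow_of_ne_zero (Nat.sub_ne_zero_of_lt (hes s hs))).mul_right _
    obtain ⟨k, hk⟩ := this
    exact ⟨k.toNat, by omega⟩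
  have hwp0 : 0 < w p := by
    rw [hwp]
    exact Finset.prod_pos fun t ht ↦ sub_pos.mpr (hSp t ht)
  have hwM0 : w M < 0 := by
    rw [hws M hMS]
    refine mul_neg_of_neg_of_pos (sub_neg.mpr (hSp M hMS)) (Finset.prod_pos fun t ht ↦ ?_)
    exact sub_pos.mpr (lt_of_le_of_ne (S.le_max' t (Finset.mem_of_mem_erase ht))
      (Finset.ne_of_mem_erase ht))
  have hsign : n p * w p = n M * w M := (hnw p hpT).trans (hnw M hMT).symm
  have key : Odd ((n p).toNat + (n M).toNat) := by
    obtain ⟨a, ha⟩ := hnodd p hep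
    obtain ⟨b, hb⟩ := hnodd M heM
    rcases lt_or_gt_of_ne (show n p ≠ 0 by omega) with h | h
    · have : 0 < n M := by
        by_contra! h'
        nlinarith
      exact ⟨b.toNat, by omega⟩
    · have : n M < 0 := by
        by_contra! h'
        nlinarith
      exact ⟨a.toNat, by omega⟩
  refine ⟨T, n, W, Finset.subset_insert _ _, ?_, hW0, hnw, ?_⟩
  · rw [hT, Finset.card_insert_of_notMem hpS]
    have := hS.card_pos
    omega
  · rw [hT, Finset.sum_insert hpS, ← Finset.add_sum_erase S _ hMS, ← add_assoc]
    refine key.add_even ?_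
    exact Finset.even_sum _ hneven

end Exponents

section ProductOfLinearFactors

open Polynomial

variable {K : Type*} [Field K]

/-- The logarithmic derivative of a product of powers of linear factors. -/
theorem derivative_prod_X_sub_C_pow_mul (T : Finset ℤ) (m : ℤ → ℕ) :
    derivative (∏ s ∈ T, (X - C (s : K)) ^ m s) * ∏ s ∈ T, (X - C (s : K)) =
      (∏ s ∈ T, (X - C (s : K)) ^ m s) *
        ∑ s ∈ T, (m s : K[X]) * ∏ t ∈ T.erase s, (X - C (t : K)) := by
  rw [derivative_prod_finset, Finset.sum_mul, Finset.mul_sum]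
  refine Finset.sum_congr rfl fun s hs ↦ ?_
  rw [← Finset.mul_prod_erase T _ hs, ← Finset.mul_prod_erase T (fun s ↦ (X - C (s : K)) ^ m s) hs,
    derivative_X_sub_C_pow]
  rcases Nat.eq_zero_or_pos (m s) with h | h
  · simp [h]
  · obtain ⟨j, hj⟩ := Nat.exists_eq_succ_of_ne_zero h.ne'
    rw [hj]
    simp only [Nat.succ_eq_add_one, Nat.add_sub_cancel, pow_succ, C_eq_natCast]
    ring

/-- For every finite nonempty set `S` of integers there is a rational function `A / B` of odd
degree over `K`, with value `1` at `∞`, that has zeros or poles at the points of `S` and whose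
finite critical points in the extension field `E` are among its zeros and poles. -/
theorem exists_fraction_of_odd_degree [CharZero K] {E : Type*} [Field E] [Algebra K E]
    (S : Finset ℤ) (hS : S.Nonempty) :
    ∃ A B : K[X], A.Monic ∧ B.Monic ∧ Odd A.natDegree ∧ A.natDegree = B.natDegree ∧
      IsCoprime A B ∧ (∀ s ∈ S, aeval (s : E) A = 0 ∨ aeval (s : E) B = 0) ∧
      ∀ b : E, aeval b A ≠ 0 → aeval b B ≠ 0 →
        aeval b (derivative A) * aeval b B ≠ aeval b A * aeval b (derivative B) := by
  classical
  obtain ⟨T, n, W, hST, hcard, hW, hnw, hodd⟩ := exists_superset_exponents S hS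
  set A : K[X] := ∏ s ∈ T, (X - C (s : K)) ^ (n s).toNat with hA
  set B : K[X] := ∏ s ∈ T, (X - C (s : K)) ^ (-n s).toNat with hB
  have hmonic (m : ℤ → ℕ) : (∏ s ∈ T, (X - C (s : K)) ^ m s).Monic :=
    monic_prod_of_monic _ _ fun s _ ↦ (monic_X_sub_C _).pow _
  have hdeg (m : ℤ → ℕ) : (∏ s ∈ T, (X - C (s : K)) ^ m s).natDegree = ∑ s ∈ T, m s := by
    rw [natDegree_prod_of_monic _ _ fun s _ ↦ (monic_X_sub_C _).pow _]
    exact Finset.sum_congr rfl fun s _ ↦ by rw [natDegree_pow, natDegree_X_sub_C, mul_one]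
  have hinj : Function.Injective (fun s : ℤ ↦ (s : K)) := Int.cast_injective
  -- partial fractions: both sides take the same values at the elements of `T`
  have hpf : ∑ s ∈ T, (n s : K[X]) * ∏ t ∈ T.erase s, (X - C (t : K)) = C (W : K) := by
    refine eq_of_degrees_lt_of_eval_finset_eq (T.image fun s : ℤ ↦ (s : K)) ?_ ?_ ?_
    · rw [Finset.card_image_of_injective _ hinj]
      refine (degree_sum_le _ _).trans_lt ?_
      rw [Finset.sup_lt_iff (WithBot.bot_lt_coe _)]
      intro s hs
      rw [← C_eq_intCast]
      refine ((degree_mul_le _ _).trans (add_le_of_nonpos_left degree_C_le)).trans_lt ?_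
      rw [degree_prod]
      simp only [degree_X_sub_C, Finset.sum_const, Finset.card_erase_of_mem hs]
      rw [nsmul_one]
      exact_mod_cast Nat.sub_lt (show 0 < T.card by omega) one_pos
    · rw [Finset.card_image_of_injective _ hinj]
      exact degree_C_le.trans_lt (by exact_mod_cast (by omega : 0 < T.card))
    · intro x hx
      obtain ⟨s, hs, rfl⟩ := Finset.mem_image.mp hx
      rw [eval_finsetSum, Finset.sum_eq_single s]
      · rw [eval_C, ← hnw s hs]
        simp [eval_prod]
      · intro t ht hts
        rw [eval_mul, eval_prod, Finset.prod_eq_zero (Finset.mem_erase.mpr ⟨hts.symm, hs⟩), mul_zero]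
        simp
      · exact fun h ↦ absurd hs h
  have hsum : ∑ s ∈ T, n s = 0 := by
    have h := congrArg (fun P ↦ P.coeff (T.card - 1)) hpf
    simp only [finsetSum_coeff, ← C_eq_intCast, coeff_C_mul] at h
    rw [coeff_C_of_ne_zero (by omega)] at h
    rw [Finset.sum_congr rfl (g := fun s ↦ ((n s : ℤ) : K)) (fun s hs ↦ ?_)] at h
    · exact_mod_cast h
    · have hm : (∏ t ∈ T.erase s, (X - C (t : K))).Monic :=
        monic_prod_of_monic _ _ fun s _ ↦ monic_X_sub_C _
      have hd : (∏ t ∈ T.erase s, (X - C (t : K))).natDegree = T.card - 1 := by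
        rw [natDegree_prod_of_monic _ _ fun s _ ↦ monic_X_sub_C _]
        simp only [natDegree_X_sub_C, Finset.sum_const, Finset.card_erase_of_mem hs, smul_eq_mul,
          mul_one]
      have := hm.coeff_natDegree
      rw [hd] at this
      rw [this, mul_one]
  have hAB : A.natDegree = B.natDegree := by
    rw [hdeg, hdeg]
    zify
    rw [← sub_eq_zero, ← Finset.sum_sub_distrib, ← hsum]
    exact Finset.sum_congr rfl fun s _ ↦ by omega
  have hn0 : ∀ s ∈ T, n s ≠ 0 := by
    intro s hs h
    apply hW
    rw [← hnw s hs, h, zero_mul]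
  have hderiv : (derivative A * B - A * derivative B) * ∏ s ∈ T, (X - C (s : K)) =
      A * B * C (W : K) := by
    have h1 := derivative_prod_X_sub_C_pow_mul (K := K) T fun s ↦ (n s).toNat
    have h2 := derivative_prod_X_sub_C_pow_mul (K := K) T fun s ↦ (-n s).toNat
    rw [← hA] at h1
    rw [← hB] at h2
    have h3 : ∑ s ∈ T, ((n s).toNat : K[X]) * ∏ t ∈ T.erase s, (X - C (t : K)) -
        ∑ s ∈ T, ((-n s).toNat : K[X]) * ∏ t ∈ T.erase s, (X - C (t : K)) = C (W : K) := by
      rw [← hpf, ← Finset.sum_sub_distrib]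
      refine Finset.sum_congr rfl fun s _ ↦ ?_
      rw [← sub_mul]
      congr 1
      have : n s = ((n s).toNat : ℤ) - ((-n s).toNat : ℤ) := by omega
      conv_rhs => rw [this]
      push_cast
      rfl
    rw [← h3]
    linear_combination B * h1 - A * h2
  refine ⟨A, B, hmonic _, hmonic _, by rwa [hdeg], hAB, ?_, fun s hs ↦ ?_, fun b hAb hBb h ↦ ?_⟩
  · refine IsCoprime.prod_left fun s hs ↦ IsCoprime.prod_right fun t ht ↦ ?_
    by_cases hst : s = t
    · subst hst
      rcases le_total 0 (n s) with h | h
      · rw [show (-n s).toNat = 0 by omega, pow_zero]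
        exact isCoprime_one_right
      · rw [show (n s).toNat = 0 by omega, pow_zero]
        exact isCoprime_one_left
    · refine IsCoprime.pow (isCoprime_X_sub_C_of_isUnit_sub ?_)
      exact (sub_ne_zero.mpr fun h ↦ hst (hinj h)).isUnit
  · have hn := hn0 s (hST hs)
    rcases lt_or_gt_of_ne hn with h | h
    · right
      rw [hB, map_prod, Finset.prod_eq_zero (hST hs)]
      simp only [map_pow, map_sub, aeval_X, map_intCast, sub_self]
      exact zero_pow (by omega)
    · left
      rw [hA, map_prod, Finset.prod_eq_zero (hST hs)]
      simp only [map_pow, map_sub, aeval_X, map_intCast, sub_self]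
      exact zero_pow (by omega)
  · have hWE : algebraMap K E (W : K) ≠ 0 := by
      rw [Ne, map_eq_zero]
      exact_mod_cast hW
    have := congrArg (aeval b) hderiv
    simp only [map_mul, map_sub, h, sub_self, zero_mul, aeval_C] at this
    exact mul_ne_zero (mul_ne_zero hAb hBb) hWE this.symm

end ProductOfLinearFactors

/-! ### Degrees of composite functions -/

section Degree

open Polynomial IntermediateField

variable {k L : Type*} [Field k] [Field L] [Algebra k L]

theorem transcendental_of_forall_ne_algebraMap [IsAlgClosed k] {f : L}
    (hf : ∀ c : k, f ≠ algebraMap k L c) : Transcendental k f := by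
  intro h
  have hi : IsIntegral k f := h.isIntegral
  obtain ⟨c, hc⟩ := minpoly.mem_range_of_degree_eq_one k f
    (IsAlgClosed.degree_eq_one_of_irreducible k (minpoly.irreducible hi))
  exact hf c hc.symm

theorem aeval_ne_zero_of_transcendental {f : L} (hf : Transcendental k f) {P : k[X]}
    (hP : P ≠ 0) : aeval f P ≠ 0 := fun h ↦ hf ⟨P, hP, h⟩

theorem RatFunc.natDegree_num_div_of_isCoprime {A B : k[X]} (hB : B ≠ 0) (h : IsCoprime A B) :
    (algebraMap k[X] (RatFunc k) A / algebraMap k[X] (RatFunc k) B).num.natDegree =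
      A.natDegree := by
  by_cases hA : A = 0
  · simp [hA]
  set u := algebraMap k[X] (RatFunc k) A / algebraMap k[X] (RatFunc k) B with hu
  have hBr : algebraMap k[X] (RatFunc k) B ≠ 0 := RatFunc.algebraMap_ne_zero hB
  have hnum : u.num ≠ 0 := by
    exact RatFunc.num_ne_zero (div_ne_zero (RatFunc.algebraMap_ne_zero hA) hBr)
  have h1 : u.num * B = A * u.denom := by
    apply RatFunc.algebraMap_injective k
    rw [map_mul, map_mul, ← div_eq_div_iff (RatFunc.algebraMap_ne_zero u.denom_ne_zero) hBr,
      RatFunc.num_div_denom]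
  refine le_antisymm (natDegree_le_of_dvd (RatFunc.num_div_dvd A hB) hA)
    (natDegree_le_of_dvd ?_ hnum)
  exact h.dvd_of_dvd_mul_right ⟨u.denom, h1⟩

/-- The degree of the composite of `f` with the rational function `A / B` is the product of the
degrees. -/
theorem finrank_adjoin_div {f : L} (hf : Transcendental k f) {A B : k[X]} (hB : B ≠ 0)
    (h : IsCoprime A B) (hdeg : B.natDegree ≤ A.natDegree) :
    Module.finrank k⟮aeval f A / aeval f B⟯ L = A.natDegree * Module.finrank k⟮f⟯ L := by
  set ψ : RatFunc k →ₐ[k] L :=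
    (k⟮f⟯).val.comp (RatFunc.algEquivOfTranscendental f hf).toAlgHom with hψ
  have hψP (P : k[X]) : ψ (algebraMap k[X] (RatFunc k) P) = aeval f P := by
    simp [hψ]
  set u := algebraMap k[X] (RatFunc k) A / algebraMap k[X] (RatFunc k) B with hu
  have hψu : ψ u = aeval f A / aeval f B := by rw [hu, map_div₀, hψP, hψP]
  have htop : (⊤ : IntermediateField k (RatFunc k)).map ψ = k⟮f⟯ := by
    rw [← RatFunc.adjoin_X, IntermediateField.adjoin_map, Set.image_singleton,
      ← RatFunc.algebraMap_X, hψP, aeval_X]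
  have hmap : (k⟮u⟯).map ψ = k⟮aeval f A / aeval f B⟯ := by
    rw [IntermediateField.adjoin_map, Set.image_singleton, hψu]
  have hle : k⟮aeval f A / aeval f B⟯ ≤ k⟮f⟯ := by
    rw [← hmap, ← htop]
    exact IntermediateField.map_mono ψ le_top
  have hd : u.denom.natDegree ≤ u.num.natDegree := by
    rw [RatFunc.natDegree_num_div_of_isCoprime hB h]
    exact (natDegree_le_of_dvd (RatFunc.denom_div_dvd A B) hB).trans hdeg
  rw [← IntermediateField.relfinrank_mul_finrank_top hle, ← hmap, ← htop,
    IntermediateField.relfinrank_map_map, IntermediateField.relfinrank_top_right,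
    RatFunc.finrank_eq_max_natDegree, max_eq_left hd,
    RatFunc.natDegree_num_div_of_isCoprime hB h]

end Degree

/-! ### Ramification of composite functions at a point -/

section Local

open Polynomial IsLocalRing

variable {k R L : Type*} [Field k] [CommRing R] [Algebra k R] [Field L] [Algebra R L] [Algebra k L]
  [IsScalarTower k R L]

theorem aeval_sub_algebraMap_eval_mem {r : R} {b : k} {I : Ideal R}
    (h : r - algebraMap k R b ∈ I) (P : k[X]) : aeval r P - algebraMap k R (P.eval b) ∈ I := by
  refine I.mem_of_dvd ?_ h
  have := sub_dvd_eval_sub r (algebraMap k R b) (P.map (algebraMap k R))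
  rwa [eval_map_algebraMap, eval_map_algebraMap, aeval_algebraMap_apply, coe_aeval_eq_eval] at this

section IsLocalRing

variable [IsLocalRing R]

theorem eq_of_sub_algebraMap_mem {r : R} {b c : k} (hb : r - algebraMap k R b ∈ maximalIdeal R)
    (hc : r - algebraMap k R c ∈ maximalIdeal R) : b = c := by
  by_contra h
  have h1 : algebraMap k R (b - c) ∈ maximalIdeal R := by
    rw [show algebraMap k R (b - c) = (r - algebraMap k R c) - (r - algebraMap k R b) by
      rw [map_sub]; ring]
    exact sub_mem hc hb
  exact (mem_maximalIdeal _).mp h1 ((sub_ne_zero.mpr h).isUnit.map _)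

theorem isUnit_aeval_of_eval_ne_zero {r : R} {b : k}
    (hb : r - algebraMap k R b ∈ maximalIdeal R) {P : k[X]} (hP : P.eval b ≠ 0) :
    IsUnit (aeval r P) := by
  by_contra h
  refine hP (eq_of_sub_algebraMap_mem (aeval_sub_algebraMap_eval_mem hb P) ?_)
  simpa using h

/-- If a polynomial has a simple root at the value of `r`, then composition with it preserves the
vanishing order. -/
theorem sub_algebraMap_mem_of_aeval_mem {r : R} {b : k} {I : Ideal R}
    (hb : r - algebraMap k R b ∈ maximalIdeal R) {H : k[X]} (h0 : H.eval b = 0)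
    (h1 : (derivative H).eval b ≠ 0) (hH : aeval r H ∈ I) : r - algebraMap k R b ∈ I := by
  obtain ⟨Q, rfl⟩ := dvd_iff_isRoot.mpr h0
  have hQ : Q.eval b ≠ 0 := by simpa [derivative_mul] using h1
  rw [map_mul, Ideal.mul_unit_mem_iff_mem _ (isUnit_aeval_of_eval_ne_zero hb hQ)] at hH
  simpa using hH

end IsLocalRing

variable [IsDomain R] [IsDiscreteValuationRing R] [IsFractionRing R L]

/-- The value `P b` of a polynomial composite `P f` at a finite branch point comes from a critical
point of `P` or from a branch point of `f`. -/
theorem exists_of_aeval_sub_mem_sq (hres : ∀ r : R, ∃ b : k, r - algebraMap k R b ∈ maximalIdeal R)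
    {f : L} {P : k[X]} (hP : P.natDegree ≠ 0) {c : k} {a : R} (ha : a ∈ maximalIdeal R ^ 2)
    (h : aeval f P - algebraMap k L c = algebraMap R L a) :
    ∃ (r : R) (b : k), f = algebraMap R L r ∧ P.eval b = c ∧
      ((derivative P).eval b = 0 ∨ r - algebraMap k R b ∈ maximalIdeal R ^ 2) := by
  have hP0 : P ≠ 0 := by rintro rfl; simp at hP
  have hint : IsIntegral R f := by
    have hm : (P * C P.leadingCoeff⁻¹).Monic := monic_mul_leadingCoeff_inv hP0
    refine IsIntegral.of_aeval_monic (hm.map (algebraMap k R)) ?_ ?_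
    · rw [hm.natDegree_map, natDegree_mul_leadingCoeff_inv _ hP0]
      exact hP
    · rw [aeval_map_algebraMap, map_mul, aeval_C, eq_add_of_sub_eq h,
        IsScalarTower.algebraMap_apply k R L, IsScalarTower.algebraMap_apply k R L, ← map_add, ← map_mul]
      exact isIntegral_algebraMap
  obtain ⟨r, rfl⟩ := IsIntegrallyClosed.isIntegral_iff.mp hint
  obtain ⟨b, hb⟩ := hres r
  have hr : aeval r P - algebraMap k R c = a := by
    apply IsFractionRing.injective R L
    rw [← h, map_sub, ← aeval_algebraMap_apply, ← IsScalarTower.algebraMap_apply]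
  have hc : P.eval b = c := by
    refine eq_of_sub_algebraMap_mem (aeval_sub_algebraMap_eval_mem hb P) ?_
    rw [hr]
    exact Ideal.pow_le_self two_ne_zero ha
  refine ⟨r, b, rfl, hc, or_iff_not_imp_left.mpr fun hd ↦ ?_⟩
  refine sub_algebraMap_mem_of_aeval_mem (H := P - C c) hb (by simp [hc]) (by simpa using hd) ?_
  rwa [map_sub, aeval_C, hr]

/-- A branch point of a composite `A(f) / B(f)` other than `0`, `1` and `∞` comes from a branch
point of `f`, if `A / B` has the value `1` at `∞` and no critical points apart from its zeros and
poles and `∞`. -/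
theorem exists_of_div_sub_mem_sq (hres : ∀ r : R, ∃ b : k, r - algebraMap k R b ∈ maximalIdeal R)
    {f : L} (hf : Transcendental k f) {A B : k[X]} (hA : A.Monic) (hB : B.Monic)
    (hdeg : A.natDegree = B.natDegree) (hAB : IsCoprime A B)
    (hcrit : ∀ b : k, A.eval b ≠ 0 → B.eval b ≠ 0 →
        (derivative A).eval b * B.eval b ≠ A.eval b * (derivative B).eval b)
    {c : k} (hc0 : c ≠ 0) (hc1 : c ≠ 1) {a : R} (ha : a ∈ maximalIdeal R ^ 2)
    (h : aeval f A / aeval f B - algebraMap k L c = algebraMap R L a) :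
    ∃ (r : R) (b : k), f = algebraMap R L r ∧ A.eval b ≠ 0 ∧ B.eval b ≠ 0 ∧
      r - algebraMap k R b ∈ maximalIdeal R ^ 2 := by
  have ham : a ∈ maximalIdeal R := Ideal.pow_le_self two_ne_zero ha
  have hBf : aeval f B ≠ 0 := aeval_ne_zero_of_transcendental hf hB.ne_zero
  have hAf : aeval f A = algebraMap R L (a + algebraMap k R c) * aeval f B := by
    rw [map_add, ← IsScalarTower.algebraMap_apply, ← eq_add_of_sub_eq h, div_mul_cancel₀ _ hBf]
  by_cases hfR : ∃ r, algebraMap R L r = f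
  · obtain ⟨r, rfl⟩ := hfR
    obtain ⟨b, hb⟩ := hres r
    have hAr : aeval r A = (a + algebraMap k R c) * aeval r B := by
      apply IsFractionRing.injective R L
      rw [map_mul, ← aeval_algebraMap_apply, ← aeval_algebraMap_apply, hAf]
    have hH : aeval r (A - C c * B) = a * aeval r B := by
      rw [map_sub, map_mul, aeval_C, hAr]
      ring
    have hH0 : (A - C c * B).eval b = 0 := by
      refine eq_of_sub_algebraMap_mem (aeval_sub_algebraMap_eval_mem hb _) ?_
      rw [map_zero, sub_zero, hH]
      exact Ideal.mul_mem_right _ _ ham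
    have hAb : A.eval b = c * B.eval b := by simpa [sub_eq_zero] using hH0
    have hB0 : B.eval b ≠ 0 := by
      intro hB0
      obtain ⟨U, V, hUV⟩ := hAB
      have := congrArg (eval b) hUV
      simp [hAb, hB0] at this
    have hA0 : A.eval b ≠ 0 := hAb ▸ mul_ne_zero hc0 hB0
    refine ⟨r, b, rfl, hA0, hB0, sub_algebraMap_mem_of_aeval_mem hb hH0 (fun hd ↦ ?_) ?_⟩
    · refine hcrit b hA0 hB0 ?_
      have : (derivative A).eval b = c * (derivative B).eval b := by
        simpa [sub_eq_zero] using hd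
      rw [this, hAb]
      ring
    · rw [hH]
      exact Ideal.mul_mem_right _ _ ha
  · -- otherwise `f` has a pole, where `A(f) / B(f)` takes the value `1`
    exfalso
    obtain ⟨s, hs⟩ := (ValuationRing.isInteger_or_isInteger R f).resolve_left hfR
    have hf0 : f ≠ 0 := by
      rintro rfl
      exact hfR ⟨0, map_zero _⟩
    have hsm : s - algebraMap k R 0 ∈ maximalIdeal R := by
      rw [map_zero, sub_zero, mem_maximalIdeal]
      intro hu
      obtain ⟨t, ht⟩ := hu.exists_right_inv
      refine hfR ⟨t, ?_⟩
      have := congrArg (algebraMap R L) ht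
      rw [map_mul, hs, map_one] at this
      rw [← mul_inv_cancel_left₀ hf0 (algebraMap R L t), this, mul_one]
    have hrev (P : k[X]) : aeval f P = algebraMap R L (aeval s P.reverse) * f ^ P.natDegree := by
      let := invertibleOfNonzero hf0
      rw [← aeval_algebraMap_apply, hs]
      have := eval₂_reverse_mul_pow (algebraMap k L) f P
      rw [invOf_eq_inv] at this
      exact this.symm
    have hrev0 {P : k[X]} (hP : P.Monic) : aeval s P.reverse - algebraMap k R 1 ∈
        maximalIdeal R := by
      have := aeval_sub_algebraMap_eval_mem hsm P.reverse
      rwa [← coeff_zero_eq_eval_zero, coeff_zero_reverse, hP.leadingCoeff] at this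
    rw [hrev A, hrev B, hdeg, ← mul_assoc, ← map_mul] at hAf
    have h3 := IsFractionRing.injective R L (mul_right_cancel₀ (pow_ne_zero _ hf0) hAf)
    refine hc1 (eq_of_sub_algebraMap_mem (r := aeval s A.reverse) ?_ (hrev0 hA))
    have h4 := Ideal.mul_mem_left _ (algebraMap k R c) (hrev0 hB)
    have h5 := Ideal.mul_mem_right (aeval s B.reverse) _ ham
    convert! add_mem h4 h5 using 1
    rw [h3, map_one]
    ring

end Local

/-! ### Branch points are algebraic over the field of definition -/

section AlgebraicDependence

open Polynomial IntermediateField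

/-- The value `P(f, t)` of a polynomial in two variables. -/
def evalPair {F S : Type*} [Field F] [CommRing S] [Algebra F S] (f t : S) : F[X][X] →+* S :=
  eval₂RingHom (aeval f : F[X] →ₐ[F] S).toRingHom t

variable {F L : Type*} [Field F] [Field L] [Algebra F L]

theorem evalPair_eq_sum {f t : L} (P : F[X][X]) {M N : ℕ} (hM : P.natDegree < M)
    (hN : ∀ j, (P.coeff j).natDegree < N) :
    evalPair f t P = ∑ j ∈ Finset.range M, ∑ i ∈ Finset.range N,
      algebraMap F L ((P.coeff j).coeff i) * (f ^ i * t ^ j) := by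
  change eval₂ _ _ _ = _
  rw [eval₂_eq_sum_range' _ hM]
  refine Finset.sum_congr rfl fun j _ ↦ ?_
  change aeval f (P.coeff j) * _ = _
  rw [aeval_eq_sum_range' (hN j), Finset.sum_mul]
  refine Finset.sum_congr rfl fun i _ ↦ ?_
  rw [Algebra.smul_def, mul_assoc]

open scoped algebraAdjoinAdjoin in
theorem isAlgebraic_adjoin_simple_iff_exists_evalPair {f : L} (hf : Transcendental F f) {t : L} :
    IsAlgebraic F⟮f⟯ t ↔ ∃ P : F[X][X], P ≠ 0 ∧ evalPair f t P = 0 := by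
  rw [← IsFractionRing.isAlgebraic_iff (Algebra.adjoin F {f}) F⟮f⟯ L]
  set e := Polynomial.algEquivOfTranscendental F f hf
  have he (p : F[X]) : algebraMap (Algebra.adjoin F {f}) L (e p) = aeval f p := by
    simp [e, Polynomial.algEquivOfTranscendental]
  have key (P : F[X][X]) : evalPair f t P = aeval t (P.map (e : F[X] →+* Algebra.adjoin F {f})) := by
    change eval₂ _ _ _ = _
    rw [aeval_def, eval₂_map]
    congr 1
    apply Polynomial.ringHom_ext
    · intro a
      simpa using (he (C a)).symm
    · simpa using (he X).symm
  constructor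
  · rintro ⟨p, hp, h⟩
    refine ⟨p.map (e.symm : Algebra.adjoin F {f} →+* F[X]), ?_, ?_⟩
    · exact (Polynomial.map_ne_zero_iff e.symm.injective).mpr hp
    · rw [key, Polynomial.map_map]
      convert h
      convert! Polynomial.map_id
      ext x
      simp
  · rintro ⟨P, hP, h⟩
    exact ⟨_, (Polynomial.map_ne_zero_iff e.injective).mpr hP, (key P) ▸ h⟩

variable {k₀ k A : Type*} [Field k₀] [Field k] [Algebra k L] [Algebra k₀ L]
  [CommRing A] [Algebra k₀ A]

/-- If linear independence over `k₀` of elements of a ring `A` is preserved in the field `L` over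
`k`, then so is algebraic independence of fractions. -/
theorem exists_evalPair_eq_zero_descend (ψ : A →ₐ[k₀] L)
    (hψ : ∀ (ι : Type) (v : ι → A), LinearIndependent k₀ v → LinearIndependent k (ψ ∘ v))
    {f : L} {a b x : A} (hb : ψ b ≠ 0) (hf : f = ψ a / ψ b)
    (h : ∃ P : k[X][X], P ≠ 0 ∧ evalPair f (ψ x) P = 0) :
    ∃ P : k₀[X][X], P ≠ 0 ∧ evalPair f (ψ x) P = 0 := by
  classical
  obtain ⟨P, hP, h0⟩ := h
  set M := P.natDegree + 1 with hM
  set N := (Finset.range M).sup (fun j ↦ (P.coeff j).natDegree) + 1 with hN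
  have hN' : ∀ j, (P.coeff j).natDegree < N := by
    intro j
    by_cases hj : j < M
    · exact Nat.lt_succ_of_le
        (Finset.le_sup (f := fun j ↦ (P.coeff j).natDegree) (Finset.mem_range.mpr hj))
    · rw [coeff_eq_zero_of_natDegree_lt (p := P) (n := j) (by omega)]
      simp [hN]
  set v : Fin M × Fin N → A := fun p ↦ a ^ (p.2 : ℕ) * b ^ (N - p.2) * x ^ (p.1 : ℕ) with hv
  have hψv (p : Fin M × Fin N) : ψ (v p) = ψ b ^ N * (f ^ (p.2 : ℕ) * ψ x ^ (p.1 : ℕ)) := by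
    have h1 : ψ a = f * ψ b := by rw [hf, div_mul_cancel₀ _ hb]
    have h2 : ψ b ^ N = ψ b ^ (N - (p.2 : ℕ)) * ψ b ^ (p.2 : ℕ) := by
      rw [← pow_add, Nat.sub_add_cancel p.2.2.le]
    simp only [hv, map_mul, map_pow]
    rw [h1, h2]
    ring
  have hdep : ¬ LinearIndependent k₀ v := by
    intro hli
    have hli' := Fintype.linearIndependent_iff.mp (hψ _ v hli)
    have := hli' (fun p ↦ (P.coeff p.1).coeff p.2) (by
      simp only [Function.comp_apply, hψv, Algebra.smul_def]
      rw [Fintype.sum_prod_type]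
      simp only [mul_left_comm _ (ψ b ^ N), ← Finset.mul_sum]
      rw [← mul_zero (ψ b ^ N), ← h0, evalPair_eq_sum P (Nat.lt_succ_self _) hN',
        Finset.sum_range]
      simp only [Finset.sum_range]
      rfl)
    refine hP (Polynomial.ext fun j ↦ Polynomial.ext fun i ↦ ?_)
    by_cases hj : j < M
    · by_cases hi : i < N
      · exact this (⟨j, hj⟩, ⟨i, hi⟩)
      · rw [coeff_eq_zero_of_natDegree_lt ((hN' j).trans_le (by omega))]
        simp
    · rw [coeff_eq_zero_of_natDegree_lt (p := P) (n := j) (by omega)]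
      simp
  rw [Fintype.not_linearIndependent_iff] at hdep
  obtain ⟨g, hg, p, hp⟩ := hdep
  refine ⟨∑ q : Fin M × Fin N, C (C (g q)) * (C (X ^ (q.2 : ℕ)) * X ^ (q.1 : ℕ)), ?_, ?_⟩
  · intro H
    refine hp ?_
    have := congrArg (fun Q ↦ (Q.coeff p.1).coeff p.2) H
    simp only [finsetSum_coeff, coeff_C_mul, coeff_X_pow, mul_ite, mul_one, mul_zero,
      coeff_zero] at this
    rw [Finset.sum_eq_single p] at this
    · simpa using this
    · rintro ⟨q1, q2⟩ - hq
      by_cases h1 : (p.1 : ℕ) = q1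
      · have h2 : (p.2 : ℕ) ≠ q2 := fun h2 ↦ hq (Prod.ext (Fin.ext h1.symm) (Fin.ext h2.symm))
        simp [h1, coeff_X_pow, h2]
      · simp [h1]
    · simp
  · have h1 : ψ b ^ N * evalPair f (ψ x) (∑ q : Fin M × Fin N,
        C (C (g q)) * (C (X ^ (q.2 : ℕ)) * X ^ (q.1 : ℕ))) = ψ (∑ q, g q • v q) := by
      rw [map_sum, map_sum, Finset.mul_sum]
      refine Finset.sum_congr rfl fun q _ ↦ ?_
      rw [map_smul, hψv, Algebra.smul_def]
      simp only [evalPair, coe_eval₂RingHom, eval₂_mul, eval₂_C, eval₂_X_pow]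
      simp
      ring
    rw [hg, map_zero] at h1
    exact (mul_eq_zero.mp h1).resolve_left (pow_ne_zero _ hb)

variable [Algebra k₀ k] [IsScalarTower k₀ k L]

/-- A function field `L` over `k` that is generated by elements of a ring `A` over `k₀` is
generated, over `k` and an element `f` of the fraction field of `A`, by one element that is
algebraic over `k₀(f)`. -/
theorem exists_adjoin_pair_eq_top [CharZero k₀] (ψ : A →ₐ[k₀] L)
    (hψ : ∀ (ι : Type) (v : ι → A), LinearIndependent k₀ v → LinearIndependent k (ψ ∘ v))
    (hgen : IntermediateField.adjoin k (Set.range ψ) = ⊤)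
    {f : L} (hf : Transcendental k f) {a b : A} (hb : ψ b ≠ 0) (hfab : f = ψ a / ψ b)
    [FiniteDimensional k⟮f⟯ L] :
    ∃ θ : L, IntermediateField.adjoin k {f, θ} = ⊤ ∧ IsAlgebraic k₀⟮f⟯ θ := by
  classical
  have hf₀ : Transcendental k₀ f := fun h ↦ hf (h.tower_top k)
  have halg : ∀ y ∈ Set.range ψ, IsAlgebraic k₀⟮f⟯ y := by
    rintro _ ⟨x, rfl⟩
    rw [isAlgebraic_adjoin_simple_iff_exists_evalPair hf₀]
    refine exists_evalPair_eq_zero_descend ψ hψ hb hfab ?_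
    rw [← isAlgebraic_adjoin_simple_iff_exists_evalPair hf]
    exact Algebra.IsAlgebraic.isAlgebraic _
  -- finitely many elements of the range of `ψ` generate `L` over `k(f)`
  obtain ⟨T, hT, hTtop⟩ : ∃ T : Finset L, (T : Set L) ⊆ Set.range ψ ∧
      IntermediateField.adjoin k⟮f⟯ (T : Set L) = ⊤ := by
    have htop : IntermediateField.adjoin k⟮f⟯ (Set.range ψ) = ⊤ := by
      rw [eq_top_iff]
      intro z _
      have hz : z ∈ IntermediateField.adjoin k (Set.range ψ) := hgen ▸ mem_top
      have hle : IntermediateField.adjoin k (Set.range ψ) ≤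
          (IntermediateField.adjoin k⟮f⟯ (Set.range ψ)).restrictScalars k :=
        adjoin_le_iff.mpr (subset_adjoin _ _)
      exact hle hz
    have hex (z : L) : ∃ T : Finset L, (T : Set L) ⊆ Set.range ψ ∧
        z ∈ IntermediateField.adjoin k⟮f⟯ (T : Set L) :=
      exists_finset_of_mem_adjoin (htop ▸ mem_top)
    choose T hT hzT using hex
    let B := Module.finBasis k⟮f⟯ L
    refine ⟨Finset.univ.biUnion fun i ↦ T (B i), ?_, ?_⟩
    · simp only [Finset.coe_biUnion, Set.iUnion_subset_iff]
      exact fun i _ ↦ hT _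
    · rw [eq_top_iff]
      intro z _
      rw [← B.sum_repr z]
      refine sum_mem fun i _ ↦ IntermediateField.smul_mem _ ?_
      refine adjoin.mono _ _ _ ?_ (hzT (B i))
      exact_mod_cast Finset.subset_biUnion_of_mem (fun i ↦ T (B i)) (Finset.mem_univ i)
  have hfd : FiniteDimensional k₀⟮f⟯ (IntermediateField.adjoin k₀⟮f⟯ (T : Set L)) :=
    finiteDimensional_adjoin fun x hx ↦ (halg x (hT hx)).isIntegral
  have : CharZero k₀⟮f⟯ := charZero_of_injective_algebraMap (algebraMap k₀ k₀⟮f⟯).injective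
  obtain ⟨α, hα⟩ := Field.exists_primitive_element k₀⟮f⟯
    (IntermediateField.adjoin k₀⟮f⟯ (T : Set L))
  have hα' : IntermediateField.adjoin k₀⟮f⟯ {(α : L)} =
      IntermediateField.adjoin k₀⟮f⟯ (T : Set L) := by
    rw [← IntermediateField.lift_adjoin_simple, hα, IntermediateField.lift_top]
  refine ⟨α, ?_, ?_⟩
  · set S := IntermediateField.adjoin k {f, (α : L)} with hS
    have hfS : f ∈ S := subset_adjoin _ _ (by simp)
    have hαS : (α : L) ∈ S := subset_adjoin _ _ (by simp)
    have h0S : k₀⟮f⟯ ≤ S.restrictScalars k₀ := by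
      rw [adjoin_simple_le_iff]
      exact hfS
    have h1S : k⟮f⟯ ≤ S := by
      rw [adjoin_simple_le_iff]
      exact hfS
    have hTS : (T : Set L) ⊆ S := by
      intro y hy
      have hy' : y ∈ IntermediateField.adjoin k₀⟮f⟯ {(α : L)} := by
        rw [hα']
        exact subset_adjoin _ _ hy
      have : IntermediateField.adjoin k₀⟮f⟯ {(α : L)} ≤ extendScalars h0S := by
        rw [adjoin_simple_le_iff]
        exact hαS
      exact this hy'
    have : IntermediateField.adjoin k⟮f⟯ (T : Set L) ≤ extendScalars h1S :=
      adjoin_le_iff.mpr hTS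
    rw [hTtop] at this
    rw [eq_top_iff]
    intro z _
    exact this mem_top
  · have : IsAlgebraic k₀⟮f⟯ α := Algebra.IsAlgebraic.isAlgebraic α
    exact this.algebraMap

end AlgebraicDependence

section Unramified

open Polynomial IntermediateField IsLocalRing

variable {k R L : Type*} [Field k] [CommRing R] [Algebra k R] [Field L] [Algebra R L] [Algebra k L]
  [IsScalarTower k R L] [IsDomain R] [IsDiscreteValuationRing R] [IsFractionRing R L]

/-- If `L = k(r, t)` with `P(r, t) = 0` and `∂P/∂Y (r, t)` is a unit at a point, then `r` is
unramified at this point: its difference from its value is a uniformizer.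

For every element `b` of `B = k[r, t]` that vanishes at the point, a unit multiple of `b` in `B`
is divisible by `r - c` in `B`. So every nonzero element of `B`, and hence of `L`, is a power of
`r - c` times a unit. -/
theorem sub_algebraMap_notMem_sq
    (hres : ∀ r : R, ∃ b : k, r - algebraMap k R b ∈ maximalIdeal R)
    {r t : R} {c : k} (hrc : r ≠ algebraMap k R c)
    (htop : IntermediateField.adjoin k {algebraMap R L r, algebraMap R L t} = ⊤)
    {P : k[X][X]} (hP : evalPair r t P = 0) (hP' : IsUnit (evalPair r t (derivative P))) :
    r - algebraMap k R c ∉ maximalIdeal R ^ 2 := by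
  intro hsq
  obtain ⟨t₀, ht₀⟩ := hres t
  have hrm : r - algebraMap k R c ∈ maximalIdeal R := Ideal.pow_le_self two_ne_zero hsq
  set B := Algebra.adjoin k {r, t} with hB
  set rB : B := ⟨r, Algebra.subset_adjoin (by simp)⟩ with hrB
  set tB : B := ⟨t, Algebra.subset_adjoin (by simp)⟩ with htB
  -- the elements of `B` are constant modulo `(r - c, t - t₀)`
  have hconst : ∀ b ∈ B, ∃ (e : k) (g₁ g₂ : B), b = algebraMap k R e +
      (r - algebraMap k R c) * g₁ + (t - algebraMap k R t₀) * g₂ := by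
    intro b hb
    induction hb using Algebra.adjoin_induction with
    | mem x hx =>
      rcases hx with rfl | rfl
      · exact ⟨c, 1, 0, by simp⟩
      · exact ⟨t₀, 0, 1, by simp⟩
    | algebraMap e => exact ⟨e, 0, 0, by simp⟩
    | add x y _ _ hx hy =>
      obtain ⟨e, g₁, g₂, rfl⟩ := hx
      obtain ⟨e', g₁', g₂', rfl⟩ := hy
      exact ⟨e + e', g₁ + g₁', g₂ + g₂', by simp; ring⟩
    | mul x y _ hyB hx hy =>
      obtain ⟨e, g₁, g₂, rfl⟩ := hx
      obtain ⟨e', g₁', g₂', h⟩ := hy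
      refine ⟨e * e', g₁ * ⟨y, hyB⟩ + algebraMap k B e * g₁',
        g₂ * ⟨y, hyB⟩ + algebraMap k B e * g₂', ?_⟩
      have hcoe : ((algebraMap k B e : B) : R) = algebraMap k R e := rfl
      simp only [map_mul, Subalgebra.coe_add, Subalgebra.coe_mul, hcoe]
      linear_combination algebraMap k R e * h
  -- `u (t - t₀) = (r - c) g` in `B`, where `u` does not vanish at the point
  obtain ⟨u, g, hu, hug⟩ : ∃ u g : B, IsUnit (u : R) ∧
      (u : R) * (t - algebraMap k R t₀) = (r - algebraMap k R c) * g := by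
    set p : B[X] := P.map (aeval rB : k[X] →ₐ[k] B).toRingHom with hp
    have hpe (Q : k[X][X]) (y : B) :
        (((Q.map (aeval rB : k[X] →ₐ[k] B).toRingHom).eval y : B) : R) = evalPair r (y : R) Q := by
      change _ = eval₂ _ _ _
      rw [Polynomial.eval_map]
      change B.val _ = _
      rw [← AlgHom.coe_toRingHom, hom_eval₂]
      congr 1
      apply Polynomial.ringHom_ext
      · intro a
        simp
      · simp [hrB]
    obtain ⟨h, hh⟩ := binomExpansion p tB (algebraMap k B t₀ - tB)
    have h1 : evalPair r (algebraMap k R t₀) P = (algebraMap k R t₀ - t) *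
        (evalPair r t (derivative P) + h * (algebraMap k R t₀ - t)) := by
      have := congrArg (fun b : B ↦ (b : R)) hh
      simp only [add_sub_cancel, Subalgebra.coe_add, Subalgebra.coe_mul, hpe, hp,
        derivative_map, Subalgebra.coe_pow] at this
      change evalPair r (algebraMap k R t₀) P = evalPair r t P + evalPair r t (derivative P) *
        (algebraMap k R t₀ - t) + h * (algebraMap k R t₀ - t) ^ 2 at this
      rw [this, hP]
      ring
    have h2 : evalPair r (algebraMap k R t₀) P = aeval r (P.eval (C t₀)) := by
      change eval₂ _ _ _ = _
      rw [← AlgHom.coe_toRingHom, ← eval₂_hom]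
      congr 1
      simp
    have ht₀' : algebraMap k R t₀ - t ∈ maximalIdeal R := by
      rw [← neg_sub]
      exact neg_mem ht₀
    have h3 : (P.eval (C t₀)).eval c = 0 := by
      refine eq_of_sub_algebraMap_mem (aeval_sub_algebraMap_eval_mem hrm _) ?_
      rw [map_zero, sub_zero, ← h2, h1]
      exact Ideal.mul_mem_right _ _ ht₀'
    obtain ⟨q, hq⟩ := dvd_iff_isRoot.mpr h3
    refine ⟨(p.derivative).eval tB + h * (algebraMap k B t₀ - tB), -aeval rB q, ?_, ?_⟩
    · have : (((p.derivative).eval tB + h * (algebraMap k B t₀ - tB) : B) : R) =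
          evalPair r t (derivative P) + h * (algebraMap k R t₀ - t) := by
        rw [hp, derivative_map, Subalgebra.coe_add, hpe]
        rfl
      rw [this]
      by_contra hnu
      refine (mem_maximalIdeal _).mp (?_ : evalPair r t (derivative P) ∈ maximalIdeal R) hP'
      rw [← add_sub_cancel_right (evalPair r t (derivative P))]
      exact sub_mem hnu (Ideal.mul_mem_left _ _ ht₀')
    · have h4 : ((aeval rB q : B) : R) = aeval r q := by
        change B.val _ = _
        rw [← aeval_algHom_apply]
        rfl
      rw [h2, hq, map_mul, map_sub, aeval_X, aeval_C] at h1
      rw [Subalgebra.coe_neg, h4, hp, derivative_map, Subalgebra.coe_add, hpe]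
      change (evalPair r t (derivative P) + h * (algebraMap k R t₀ - t)) * _ = _
      linear_combination h1
  have ha0 : r - algebraMap k R c ≠ 0 := sub_ne_zero.mpr hrc
  have hpow : ∀ b : R, b ∈ B → b ≠ 0 → ∃ j : ℕ, Associated b ((r - algebraMap k R c) ^ j) := by
    intro b
    induction b using IsWellFounded.induction (DvdNotUnit : R → R → Prop) with
    | _ b ih =>
    intro hbB hb0
    by_cases hbu : IsUnit b
    · exact ⟨0, by simpa using associated_one_iff_isUnit.mpr hbu⟩
    obtain ⟨e, g₁, g₂, hb⟩ := hconst b hbB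
    have he : e = 0 := by
      refine eq_of_sub_algebraMap_mem (r := b) ?_ (by simpa using hbu)
      rw [hb, add_assoc, add_sub_cancel_left]
      exact add_mem (Ideal.mul_mem_right _ _ hrm) (Ideal.mul_mem_right _ _ ht₀)
    have hub : (u : R) * b = (r - algebraMap k R c) * ((u * g₁ + g * g₂ : B) : R) := by
      rw [hb, he, map_zero]
      push_cast
      linear_combination (g₂ : R) * hug
    set b' : R := ((u * g₁ + g * g₂ : B) : R) with hb'
    have hb'0 : b' ≠ 0 := by
      intro h
      rw [h, mul_zero] at hub
      exact (mul_ne_zero hu.ne_zero hb0) hub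
    obtain ⟨w, hw⟩ := hu
    have hbb : b = b' * (↑w⁻¹ * (r - algebraMap k R c)) := by
      rw [← hw] at hub
      rw [← Units.inv_mul_cancel_left w b, hub]
      ring
    obtain ⟨j, hj⟩ := ih b' ⟨hb'0, _, by
      rw [← mem_nonunits_iff, ← mem_maximalIdeal]
      exact Ideal.mul_mem_left _ _ hrm, hbb⟩ (u * g₁ + g * g₂ : B).2 hb'0
    refine ⟨j + 1, ?_⟩
    rw [hbb, pow_succ]
    exact hj.mul_mul (associated_unit_mul_left _ _ w⁻¹.isUnit)
  obtain ⟨ϖ, hϖ⟩ := IsDiscreteValuationRing.exists_irreducible R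
  have hϖsq : ϖ ∉ maximalIdeal R ^ 2 := by
    rw [hϖ.maximalIdeal_eq, Ideal.span_singleton_pow, Ideal.mem_span_singleton, sq]
    rintro ⟨z, hz⟩
    refine hϖ.not_isUnit (IsUnit.of_mul_eq_one z ?_)
    exact mul_left_cancel₀ hϖ.ne_zero (by rw [← mul_assoc, ← hz, mul_one])
  obtain ⟨x, hx, y, hy, hxy⟩ := mem_adjoin_iff_div.mp
    (htop ▸ mem_top : algebraMap R L ϖ ∈ IntermediateField.adjoin k
      {algebraMap R L r, algebraMap R L t})
  have himg : Algebra.adjoin k {algebraMap R L r, algebraMap R L t} =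
      B.map (IsScalarTower.toAlgHom k R L) := by
    rw [hB, AlgHom.map_adjoin, Set.image_pair]
    rfl
  rw [himg] at hx hy
  obtain ⟨b₁, hb₁, rfl⟩ := hx
  obtain ⟨b₂, hb₂, rfl⟩ := hy
  change algebraMap R L ϖ = algebraMap R L b₁ / algebraMap R L b₂ at hxy
  have hϖ0 : algebraMap R L ϖ ≠ 0 := by
    rw [Ne, IsFractionRing.to_map_eq_zero_iff]
    exact hϖ.ne_zero
  have hb₂0 : algebraMap R L b₂ ≠ 0 := by
    intro h
    rw [h, div_zero] at hxy
    exact hϖ0 hxy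
  have hb : ϖ * b₂ = b₁ := by
    apply IsFractionRing.injective R L
    rw [map_mul, hxy, div_mul_cancel₀ _ hb₂0]
  have hb₂0' : b₂ ≠ 0 := by
    rintro rfl
    exact hb₂0 (map_zero _)
  obtain ⟨i, hi⟩ := hpow b₁ hb₁ (hb ▸ mul_ne_zero hϖ.ne_zero hb₂0')
  obtain ⟨j, hj⟩ := hpow b₂ hb₂ hb₂0'
  have hij : Associated (ϖ * (r - algebraMap k R c) ^ j) ((r - algebraMap k R c) ^ i) :=
    ((Associated.refl ϖ).mul_mul hj.symm).trans (hb ▸ hi)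
  rcases le_or_gt i j with hle | hlt
  · refine hϖ.not_isUnit (isUnit_of_dvd_one ?_)
    obtain ⟨d, rfl⟩ := Nat.exists_eq_add_of_le hle
    have : (r - algebraMap k R c) ^ i * (ϖ * (r - algebraMap k R c) ^ d) ∣
        (r - algebraMap k R c) ^ i * 1 := by
      rw [mul_one]
      refine (Eq.dvd ?_).trans hij.dvd
      ring
    exact (dvd_mul_right _ _).trans ((mul_dvd_mul_iff_left (pow_ne_zero i ha0)).mp this)
  · obtain ⟨d, rfl⟩ := Nat.exists_eq_add_of_lt hlt
    have : (r - algebraMap k R c) ^ j * (r - algebraMap k R c) ^ (d + 1) ∣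
        (r - algebraMap k R c) ^ j * ϖ := by
      rw [← pow_add, ← add_assoc, mul_comm _ ϖ]
      exact hij.symm.dvd
    refine hϖsq (Ideal.mem_of_dvd _ ?_ hsq)
    exact (dvd_pow_self _ (Nat.succ_ne_zero d)).trans
      ((mul_dvd_mul_iff_left (pow_ne_zero j ha0)).mp this)

end Unramified

section BranchValues

open Polynomial IntermediateField IsLocalRing

theorem evalPair_algebraMap {k R L : Type*} [Field k] [CommRing R] [Algebra k R] [Field L]
    [Algebra R L] [Algebra k L] [IsScalarTower k R L] (r t : R) (P : k[X][X]) :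
    algebraMap R L (evalPair r t P) = evalPair (algebraMap R L r) (algebraMap R L t) P := by
  change algebraMap R L (eval₂ _ _ _) = eval₂ _ _ _
  rw [hom_eval₂]
  congr 1
  apply Polynomial.ringHom_ext
  · intro a
    simp [← IsScalarTower.algebraMap_apply]
  · simp

theorem evalPair_map {k₀ k L : Type*} [Field k₀] [Field k] [Field L] [Algebra k₀ k] [Algebra k L]
    [Algebra k₀ L] [IsScalarTower k₀ k L] (f t : L) (P : k₀[X][X]) :
    evalPair f t (P.map (mapRingHom (algebraMap k₀ k))) = evalPair f t P := by
  change eval₂ _ _ _ = eval₂ _ _ _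
  rw [eval₂_map]
  congr 1
  apply Polynomial.ringHom_ext
  · intro a
    simp [← IsScalarTower.algebraMap_apply]
  · simp

theorem isIntegral_of_isUnit_leadingCoeff {R S : Type*} [CommRing R] [CommRing S] [Algebra R S]
    {p : R[X]} (hp : IsUnit p.leadingCoeff) {x : S} (hx : aeval x p = 0) : IsIntegral R x := by
  obtain ⟨u, hu⟩ := hp
  refine ⟨C (↑u⁻¹ : R) * p, ?_, ?_⟩
  · have := monic_C_mul_of_mul_leadingCoeff_eq_one (b := (↑u⁻¹ : R)) (p := p) (by rw [← hu]; simp)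
    exact this
  · rw [eval₂_mul, ← aeval_def x p, hx, mul_zero]

section

variable {F L : Type*} [Field F] [Field L] [Algebra F L] {f : L}

/-- The element `w` divides a nonzero polynomial in `f`: this is a relation `Q(f, w) = 0` with
nonzero constant term. -/
theorem exists_evalPair_eq_zero_coeff_zero_ne_zero (hf : Transcendental F f) {w : L} (hw : w ≠ 0)
    (halg : IsAlgebraic F⟮f⟯ w) : ∃ Q : F[X][X], Q.coeff 0 ≠ 0 ∧ evalPair f w Q = 0 := by
  rw [isAlgebraic_adjoin_simple_iff_exists_evalPair hf] at halg
  obtain ⟨Q, ⟨hQ, hQw⟩, hmin⟩ := WellFounded.has_min (measure natDegree).wf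
    {Q : F[X][X] | Q ≠ 0 ∧ evalPair f w Q = 0} halg
  refine ⟨Q, fun h0 ↦ ?_, hQw⟩
  obtain ⟨Q', rfl⟩ := X_dvd_iff.mpr h0
  have hQ' : Q' ≠ 0 := right_ne_zero_of_mul hQ
  have hX : evalPair f w (X : F[X][X]) = w := eval₂_X _ _
  rw [map_mul, hX] at hQw
  refine hmin Q' ⟨hQ', (mul_eq_zero.mp hQw).resolve_left hw⟩ ?_
  change natDegree Q' < natDegree (X * Q')
  rw [natDegree_X_mul hQ']
  exact Nat.lt_succ_self _

/-- A relation `P(f, θ) = 0` of minimal degree is separable in characteristic zero. -/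
theorem exists_evalPair_eq_zero_derivative_ne_zero [CharZero F] (hf : Transcendental F f) {θ : L}
    (halg : IsAlgebraic F⟮f⟯ θ) :
    ∃ P : F[X][X], P ≠ 0 ∧ evalPair f θ P = 0 ∧ evalPair f θ (derivative P) ≠ 0 := by
  rw [isAlgebraic_adjoin_simple_iff_exists_evalPair hf] at halg
  obtain ⟨P, ⟨hP, hPθ⟩, hmin⟩ := WellFounded.has_min (measure natDegree).wf
    {P : F[X][X] | P ≠ 0 ∧ evalPair f θ P = 0} halg
  refine ⟨P, hP, hPθ, fun h ↦ ?_⟩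
  by_cases hd : P.natDegree = 0
  · rw [eq_C_of_natDegree_eq_zero hd] at hPθ hP
    refine aeval_ne_zero_of_transcendental hf (P := P.coeff 0) (by simpa using hP) ?_
    rw [← hPθ]
    exact (eval₂_C _ _).symm
  · exact hmin (derivative P) ⟨fun h ↦ hd (derivative_eq_zero.mp h), h⟩
      (natDegree_derivative_lt hd)

theorem isAlgebraic_evalPair {θ : L} (halg : IsAlgebraic F⟮f⟯ θ) (P : F[X][X]) :
    IsAlgebraic F⟮f⟯ (evalPair f θ P) := by
  rw [← mem_algebraicClosure_iff] at halg ⊢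
  have hN (j) : (P.coeff j).natDegree <
      (Finset.range (P.natDegree + 1)).sup (fun j ↦ (P.coeff j).natDegree) + 1 := by
    by_cases hj : j < P.natDegree + 1
    · exact Nat.lt_succ_of_le
        (Finset.le_sup (f := fun j ↦ (P.coeff j).natDegree) (Finset.mem_range.mpr hj))
    · rw [coeff_eq_zero_of_natDegree_lt (by omega)]
      simp
  rw [evalPair_eq_sum P (Nat.lt_succ_self _) hN]
  have hfm : f ∈ algebraicClosure F⟮f⟯ L :=
    (algebraicClosure F⟮f⟯ L).algebraMap_mem (AdjoinSimple.gen F f)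
  refine sum_mem fun j _ ↦ sum_mem fun i _ ↦ mul_mem ?_ (mul_mem (pow_mem hfm _) (pow_mem halg _))
  exact (algebraicClosure F⟮f⟯ L).algebraMap_mem (algebraMap F F⟮f⟯ _)

end

/-- The finite branch values of `f` are roots of a nonzero polynomial over the field of
definition. With `θ` a generator as in `exists_adjoin_pair_eq_top` and `P(f, θ) = 0` a separable
relation, this polynomial is the product of the leading coefficient of `P` and of a multiple of
`∂P/∂Y (f, θ)`; where it does not vanish, `θ` is regular and `∂P/∂Y (f, θ)` is a unit. -/
theorem exists_aeval_eq_zero_of_branch_value {k₀ k A L : Type*} [Field k₀] [Field k] [Field L]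
    [Algebra k₀ k] [Algebra k L] [Algebra k₀ L] [IsScalarTower k₀ k L] [CommRing A] [Algebra k₀ A]
    [CharZero k₀] (ψ : A →ₐ[k₀] L)
    (hψ : ∀ (ι : Type) (v : ι → A), LinearIndependent k₀ v → LinearIndependent k (ψ ∘ v))
    (hgen : IntermediateField.adjoin k (Set.range ψ) = ⊤)
    {f : L} (hf : Transcendental k f) {a b : A} (hb : ψ b ≠ 0) (hfab : f = ψ a / ψ b)
    [FiniteDimensional k⟮f⟯ L] :
    ∃ D : k₀[X], D ≠ 0 ∧ ∀ (R : Type) [CommRing R] [IsDomain R] [IsDiscreteValuationRing R]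
      [Algebra k R] [Algebra R L] [IsScalarTower k R L] [IsFractionRing R L]
      (_ : ∀ r : R, ∃ b : k, r - algebraMap k R b ∈ maximalIdeal R) (r : R) (c : k),
      algebraMap R L r = f → r - algebraMap k R c ∈ maximalIdeal R ^ 2 → aeval c D = 0 := by
  have hf₀ : Transcendental k₀ f := fun h ↦ hf (h.tower_top k)
  obtain ⟨θ, htop, halg⟩ := exists_adjoin_pair_eq_top ψ hψ hgen hf hb hfab
  obtain ⟨P, hP, hPθ, hw⟩ := exists_evalPair_eq_zero_derivative_ne_zero hf₀ halg
  obtain ⟨Q, hQ, hQw⟩ := exists_evalPair_eq_zero_coeff_zero_ne_zero hf₀ hw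
    (isAlgebraic_evalPair halg _)
  refine ⟨P.leadingCoeff * Q.coeff 0, mul_ne_zero (leadingCoeff_ne_zero.mpr hP) hQ, ?_⟩
  intro R _ _ _ _ _ _ _ hres r c hrf hrc
  by_contra hD
  rw [map_mul] at hD
  obtain ⟨hD₁, hD₂⟩ := mul_ne_zero_iff.mp hD
  have hrm := Ideal.pow_le_self two_ne_zero hrc
  set σ := mapRingHom (algebraMap k₀ k) with hσ
  have hσinj : Function.Injective σ := map_injective _ (algebraMap k₀ k).injective
  have hunit {p : k₀[X]} (hp : aeval c p ≠ 0) : IsUnit (aeval r (σ p)) := by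
    refine isUnit_aeval_of_eval_ne_zero hrm ?_
    simpa [hσ, eval_map_algebraMap] using hp
  -- `θ` is regular at the point
  obtain ⟨t, rfl⟩ : ∃ t, algebraMap R L t = θ := by
    refine IsIntegrallyClosed.isIntegral_iff.mp (isIntegral_of_isUnit_leadingCoeff
      (p := (P.map σ).map (aeval r : k[X] →ₐ[k] R).toRingHom) ?_ ?_)
    · rw [leadingCoeff_map_of_leadingCoeff_ne_zero]
      · rw [leadingCoeff_map_of_injective hσinj]
        exact hunit hD₁
      · rw [leadingCoeff_map_of_injective hσinj]
        exact (hunit hD₁).ne_zero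
    · rw [← hPθ, ← evalPair_map (k := k), aeval_def, eval₂_map, ← hrf]
      change _ = eval₂ _ _ _
      congr 1
      apply Polynomial.ringHom_ext
      · intro a
        simp [← IsScalarTower.algebraMap_apply]
      · simp
  have hPr : evalPair r t (P.map σ) = 0 := by
    apply IsFractionRing.injective R L
    rw [evalPair_algebraMap, hrf, evalPair_map, hPθ, map_zero]
  refine sub_algebraMap_notMem_sq hres (c := c) (L := L) (P := P.map σ) (t := t) ?_ ?_ hPr ?_ hrc
  · rintro rfl
    refine hf ⟨X - C c, X_sub_C_ne_zero c, ?_⟩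
    rw [← hrf, ← IsScalarTower.algebraMap_apply]
    simp
  · rw [hrf, htop]
  · have hQr : evalPair r (evalPair r t (derivative (P.map σ))) (Q.map σ) = 0 := by
      apply IsFractionRing.injective R L
      rw [evalPair_algebraMap, evalPair_algebraMap, hrf, derivative_map, evalPair_map,
        evalPair_map, hQw, map_zero]
    rw [← X_mul_divX_add (Q.map σ), map_add, map_mul, coeff_map] at hQr
    have hX (y : R) : evalPair r y (X : k[X][X]) = y := eval₂_X _ _
    have hC (y : R) (p : k[X]) : evalPair r y (C p) = aeval r p := eval₂_C _ _
    rw [hX, hC] at hQr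
    refine isUnit_of_dvd_unit ?_ (hunit hD₂)
    exact ⟨-evalPair r (evalPair r t (derivative (P.map σ))) (Q.map σ).divX,
      by linear_combination hQr⟩

end BranchValues

/-! ### The local rings at the closed points of a smooth curve -/

section SmoothAlgebra

open IsLocalRing KaehlerDifferential

theorem exists_sub_algebraMap_mem {k B : Type*} [Field k] [IsAlgClosed k] [CommRing B]
    [Algebra k B] [Algebra.FiniteType k B] (m : Ideal B) [m.IsMaximal] (b : B) :
    ∃ c : k, b - algebraMap k B c ∈ m := by
  let : Field (B ⧸ m) := Ideal.Quotient.field m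
  have : Algebra.FiniteType k (B ⧸ m) :=
    .of_surjective (Ideal.Quotient.mkₐ k m) Ideal.Quotient.mk_surjective
  have : Module.Finite k (B ⧸ m) := finite_of_finite_type_of_isJacobsonRing k (B ⧸ m)
  obtain ⟨c, hc⟩ := (IsAlgClosed.algebraMap_bijective_of_isIntegral (k := k) (K := B ⧸ m)).2
    (Ideal.Quotient.mk m b)
  exact ⟨c, Ideal.Quotient.eq.mp (hc.symm.trans rfl)⟩

section

variable {k B : Type*} [Field k] [CommRing B] [Algebra k B] {m : Ideal B}

/-- The derivation `b ↦ [b - b(x)]` with values in the cotangent space `m / m²` of a rational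
point `x` with ideal `m`; here `v b` is the value `b(x)`. -/
def cotangentDerivation (hm : m ≠ ⊤) (v : B → k) (hv : ∀ b, b - algebraMap k B (v b) ∈ m) :
    Derivation k B m.Cotangent :=
  have huniq (c d : k) (b : B) (hc : b - algebraMap k B c ∈ m) (hd : b - algebraMap k B d ∈ m) :
      c = d := by
    by_contra h
    refine hm (Ideal.eq_top_of_isUnit_mem m (x := algebraMap k B (d - c)) ?_
      ((sub_ne_zero.mpr (Ne.symm h)).isUnit.map _))
    rw [show algebraMap k B (d - c) = (b - algebraMap k B c) - (b - algebraMap k B d) by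
      rw [map_sub]; ring]
    exact sub_mem hc hd
  have hadd (a b : B) : v (a + b) = v a + v b := huniq _ _ (a + b) (hv _) <| by
    rw [show a + b - algebraMap k B (v a + v b) =
      (a - algebraMap k B (v a)) + (b - algebraMap k B (v b)) by rw [map_add]; ring]
    exact add_mem (hv a) (hv b)
  have hmul (a b : B) : v (a * b) = v a * v b := huniq _ _ (a * b) (hv _) <| by
    rw [show a * b - algebraMap k B (v a * v b) = a * (b - algebraMap k B (v b)) +
      algebraMap k B (v b) * (a - algebraMap k B (v a)) by rw [map_mul]; ring]
    exact add_mem (Ideal.mul_mem_left _ _ (hv b)) (Ideal.mul_mem_left _ _ (hv a))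
  have hconst (c : k) : v (algebraMap k B c) = c := huniq _ _ (algebraMap k B c) (hv _) (by simp)
  Derivation.mk'
    { toFun b := m.toCotangent ⟨b - algebraMap k B (v b), hv b⟩
      map_add' a b := by
        rw [← map_add]
        congr 1
        ext
        simp only [hadd, map_add, Submodule.coe_add]
        ring
      map_smul' c b := by
        change _ = c • m.toCotangent ⟨b - algebraMap k B (v b), hv b⟩
        rw [← algebraMap_smul B c (m.toCotangent _), ← map_smul]
        congr 1
        ext
        rw [Submodule.coe_smul, smul_eq_mul, Algebra.smul_def]
        change algebraMap k B c * b - algebraMap k B (v (algebraMap k B c * b)) = _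
        rw [hmul, hconst, map_mul, mul_sub] }
    (fun a b ↦ by
      change m.toCotangent _ = a • m.toCotangent _ + b • m.toCotangent _
      rw [← map_smul, ← map_smul, ← map_add, Ideal.toCotangent_eq]
      have : a * b - algebraMap k B (v (a * b)) - (a * (b - algebraMap k B (v b)) +
          b * (a - algebraMap k B (v a))) =
          -((a - algebraMap k B (v a)) * (b - algebraMap k B (v b))) := by
        rw [hmul, map_mul]
        ring
      change a * b - algebraMap k B (v (a * b)) - (a * (b - algebraMap k B (v b)) +
          b * (a - algebraMap k B (v a))) ∈ m ^ 2
      rw [this, sq]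
      exact neg_mem (Ideal.mul_mem_mul (hv a) (hv b)))

theorem cotangentDerivation_apply_of_mem (hm : m ≠ ⊤) (v : B → k)
    (hv : ∀ b, b - algebraMap k B (v b) ∈ m) {b : B} (hb : b ∈ m) :
    cotangentDerivation hm v hv b = m.toCotangent ⟨b, hb⟩ := by
  change m.toCotangent _ = _
  have h0 : v b = 0 := by
    by_contra h
    refine hm (Ideal.eq_top_of_isUnit_mem m (x := algebraMap k B (v b)) ?_
      ((Ne.isUnit h).map _))
    rw [← sub_sub_cancel b (algebraMap k B (v b))]
    exact sub_mem hb (hv b)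
  congr 1
  ext
  simp [h0]

end

/-- The cotangent space at a rational point is a quotient of the module of differentials. So it is
generated by one element if the module of differentials is. -/
theorem exists_le_span_sup_sq {k B : Type*} [Field k] [IsAlgClosed k] [CommRing B]
    [Algebra k B] [Algebra.FiniteType k B] (m : Ideal B) [hmax : m.IsMaximal]
    {ω : Ω[B⁄k]} (hω : Submodule.span B {ω} = ⊤) :
    ∃ g ∈ m, m ≤ Ideal.span {g} ⊔ m ^ 2 := by
  choose v hv using exists_sub_algebraMap_mem (k := k) m
  set D := cotangentDerivation hmax.ne_top v hv
  obtain ⟨⟨g, hg⟩, hgω⟩ := m.toCotangent_surjective (D.liftKaehlerDifferential ω)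
  refine ⟨g, hg, fun b hb ↦ ?_⟩
  obtain ⟨a, ha⟩ := Submodule.mem_span_singleton.mp
    (hω ▸ Submodule.mem_top : KaehlerDifferential.D k B b ∈ Submodule.span B {ω})
  have h1 : m.toCotangent ⟨b, hb⟩ = m.toCotangent (a • ⟨g, hg⟩) := by
    rw [← cotangentDerivation_apply_of_mem hmax.ne_top v hv hb, map_smul, hgω, ← map_smul, ha]
    exact (D.liftKaehlerDifferential_comp_D b).symm
  rw [Ideal.toCotangent_eq] at h1
  rw [← add_sub_cancel (a * g) b]
  exact add_mem (Ideal.mem_sup_left (Ideal.mul_mem_left _ _ (Ideal.mem_span_singleton_self g)))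
    (Ideal.mem_sup_right h1)

/-- The localization of a smooth algebra of relative dimension one over an algebraically closed
field at a maximal ideal is a noetherian local ring with principal maximal ideal, whose residue
field is the base field. -/
theorem localization_of_isStandardSmooth {k B S : Type*} [Field k] [IsAlgClosed k] [CommRing B]
    [Algebra k B] [Algebra.IsStandardSmoothOfRelativeDimension 1 k B] [Nontrivial B] (m : Ideal B)
    [hmax : m.IsMaximal] [CommRing S] [Algebra B S] [IsLocalRing S] [IsLocalization.AtPrime S m] :
    IsNoetherianRing S ∧ (maximalIdeal S).IsPrincipal ∧
      ∀ s : S, ∃ c : k, s - algebraMap B S (algebraMap k B c) ∈ maximalIdeal S := by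
  have : Algebra.IsStandardSmooth k B :=
    Algebra.IsStandardSmoothOfRelativeDimension.isStandardSmooth 1
  have : IsNoetherianRing B := Algebra.FiniteType.isNoetherianRing k B
  have hS : IsNoetherianRing S := IsLocalization.isNoetherianRing m.primeCompl S inferInstance
  have hmem {b : B} : algebraMap B S b ∈ maximalIdeal S ↔ b ∈ m :=
    IsLocalization.AtPrime.to_map_mem_maximal_iff S m b
  refine ⟨hS, ?_, fun s ↦ ?_⟩
  · have hrank : Module.finrank B Ω[B⁄k] = 1 := by
      rw [Module.finrank, Algebra.IsStandardSmoothOfRelativeDimension.rank_kaehlerDifferential 1]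
      simp
    have hfree : Module.Free B Ω[B⁄k] := inferInstance
    obtain ⟨ω, hω⟩ : ∃ ω : Ω[B⁄k], Submodule.span B {ω} = ⊤ := by
      let e := Module.finBasisOfFinrankEq B Ω[B⁄k] hrank
      exact ⟨e default, by rw [← e.span_eq, Set.range_unique]⟩
    obtain ⟨g, hg, hle⟩ := exists_le_span_sup_sq m hω
    have hmap : m.map (algebraMap B S) = maximalIdeal S :=
      IsLocalization.AtPrime.map_eq_maximalIdeal m S
    refine ⟨algebraMap B S g, le_antisymm ?_ ?_⟩
    · refine Submodule.le_of_le_smul_of_le_jacobson_bot (I := maximalIdeal S)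
        ((isNoetherianRing_iff_ideal_fg S).mp hS _) (IsLocalRing.maximalIdeal_le_jacobson _) ?_
      have := Ideal.map_mono (f := algebraMap B S) hle
      rw [Ideal.map_sup, Ideal.map_pow, Ideal.map_span, Set.image_singleton, hmap, sq] at this
      exact this
    · change Ideal.span _ ≤ _
      rw [Ideal.span_singleton_le_iff_mem]
      exact hmem.mpr hg
  · obtain ⟨b, d, rfl⟩ := IsLocalization.exists_mk'_eq m.primeCompl s
    obtain ⟨cb, hcb⟩ := exists_sub_algebraMap_mem (k := k) m b
    obtain ⟨cd, hcd⟩ := exists_sub_algebraMap_mem (k := k) m (d : B)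
    have hcd0 : cd ≠ 0 := by
      rintro rfl
      exact d.2 (by simpa using hcd)
    refine ⟨cb / cd, ?_⟩
    have hd : IsUnit (algebraMap B S d) := IsLocalization.map_units S d
    rw [← Ideal.mul_unit_mem_iff_mem _ hd, sub_mul, IsLocalization.mk'_spec, ← map_mul, ← map_sub,
      hmem]
    have : b - algebraMap k B (cb / cd) * d = (b - algebraMap k B cb) -
        algebraMap k B (cb / cd) * (d - algebraMap k B cd) := by
      rw [mul_sub, ← map_mul, div_mul_cancel₀ _ hcd0]
      ring
    rw [this]
    exact sub_mem hcb (Ideal.mul_mem_left _ _ hcd)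

end SmoothAlgebra

section ClosedPoint

open IsLocalRing

namespace SmoothProjectiveCurve

variable {k : Type} [Field k] (X : SmoothProjectiveCurve k)

/-- The inclusion of the constants into the local ring at `x`. -/
def constStalk (x : X.carrier) : k →+* X.carrier.presheaf.stalk x :=
  (X.carrier.presheaf.germ ⊤ x trivial).hom.comp
    (X.str.appTop.hom.comp (Scheme.ΓSpecIso (.of k)).inv.hom)

instance (x : X.carrier) : Algebra k (X.carrier.presheaf.stalk x) := (X.constStalk x).toAlgebra

instance (x : X.carrier) : IsScalarTower k (X.carrier.presheaf.stalk x) X.Mero := by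
  refine IsScalarTower.of_algebraMap_eq fun c ↦ ?_
  change (X.carrier.presheaf.germ ⊤ (genericPoint X.carrier) trivial).hom _ =
    (X.carrier.presheaf.stalkSpecializes _).hom ((X.carrier.presheaf.germ ⊤ x trivial).hom _)
  rw [← X.carrier.presheaf.germ_stalkSpecializes (U := ⊤) (y := x) trivial]
  rfl

/-- The local ring at a closed point is noetherian with principal maximal ideal and residue
field `k`. -/
theorem stalk_of_isClosed [IsAlgClosed k] {x : X.carrier} (hx : IsClosed {x}) :
    IsNoetherianRing (X.carrier.presheaf.stalk x) ∧
      (maximalIdeal (X.carrier.presheaf.stalk x)).IsPrincipal ∧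
      ∀ s : X.carrier.presheaf.stalk x, ∃ c : k,
        s - algebraMap k (X.carrier.presheaf.stalk x) c ∈
          maximalIdeal (X.carrier.presheaf.stalk x) := by
  obtain ⟨U, hU, V, hV, hxV, e, hsm⟩ :=
    SmoothOfRelativeDimension.exists_isStandardSmoothOfRelativeDimension (n := 1) (f := X.str) x
  obtain rfl : U = ⊤ := by
    rw [eq_top_iff]
    intro y _
    have : y = X.str x := Subsingleton.elim (α := PrimeSpectrum k) _ _
    rw [this]
    exact e hxV
  set φ : k →+* Γ(X.carrier, V) :=
    (X.str.appLE ⊤ V e).hom.comp (Scheme.ΓSpecIso (.of k)).inv.hom with hφ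
  have hφsm : φ.IsStandardSmoothOfRelativeDimension 1 :=
    RingHom.isStandardSmoothOfRelativeDimension_respectsIso.2 _
      (Scheme.ΓSpecIso (.of k)).symm.commRingCatIsoToRingEquiv hsm
  algebraize [φ]
  have : Nontrivial Γ(X.carrier, V) := by
    have : Nonempty V := ⟨⟨x, hxV⟩⟩
    infer_instance
  have hmax : (hV.primeIdealOf ⟨x, hxV⟩).asIdeal.IsMaximal := by
    rw [← PrimeSpectrum.isClosed_singleton_iff_isMaximal]
    have hpre : ({⟨x, hxV⟩} : Set V) = Subtype.val ⁻¹' {x} := by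
      ext y
      exact Subtype.ext_iff
    have h1 : IsClosed ({⟨x, hxV⟩} : Set V) := hpre ▸ hx.preimage continuous_subtype_val
    have h2 := hV.isoSpec.hom.homeomorph.isClosedMap _ h1
    exact (Set.image_singleton (f := hV.isoSpec.hom.homeomorph) (a := ⟨x, hxV⟩)) ▸ h2
  let := TopCat.Presheaf.algebra_section_stalk X.carrier.presheaf (U := V) ⟨x, hxV⟩
  have hloc : IsLocalization.AtPrime (X.carrier.presheaf.stalk x)
    (hV.primeIdealOf ⟨x, hxV⟩).asIdeal := hV.isLocalization_stalk ⟨x, hxV⟩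
  obtain ⟨h1, h2, h3⟩ := localization_of_isStandardSmooth (k := k) (B := Γ(X.carrier, V))
    (S := X.carrier.presheaf.stalk x) (hV.primeIdealOf ⟨x, hxV⟩).asIdeal
  refine ⟨h1, h2, fun s ↦ ?_⟩
  obtain ⟨c, hc⟩ := h3 s
  refine ⟨c, ?_⟩
  convert hc using 2
  change (X.carrier.presheaf.germ ⊤ x trivial).hom (X.str.appTop.hom _) =
    (X.carrier.presheaf.germ V x hxV).hom ((X.str.appLE ⊤ V e).hom _)
  rw [Scheme.Hom.appLE, CommRingCat.hom_comp, RingHom.comp_apply]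
  exact (X.carrier.presheaf.germ_res_apply (homOfLE e) x hxV _).symm

/-- If a nonzero function vanishes doubly at a closed point `x`, then the local ring at `x` is a
discrete valuation ring. -/
theorem isDiscreteValuationRing_stalk [IsAlgClosed k] {x : X.carrier} (hx : IsClosed {x})
    {g : X.Mero} (hg : g ≠ 0) (hgx : VanishesDoublyAt g x) :
    IsDiscreteValuationRing (X.carrier.presheaf.stalk x) := by
  obtain ⟨h1, h2, -⟩ := X.stalk_of_isClosed hx
  have hnf : ¬ IsField (X.carrier.presheaf.stalk x) := by
    rw [isField_iff_maximalIdeal_eq]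
    intro h
    obtain ⟨a, ha, rfl⟩ := hgx
    rw [h, ← Ideal.zero_eq_bot, zero_pow two_ne_zero] at ha
    exact hg (by rw [ha, map_zero])
  exact ((IsDiscreteValuationRing.TFAE _ hnf).out 0 4).mpr h2

end SmoothProjectiveCurve

end ClosedPoint

/-! ### Functions defined over the smaller field -/

section Model

namespace SmoothProjectiveCurve

variable {k k₀ : Type} [Field k] [Field k₀] {ι : k₀ →+* k} {X : SmoothProjectiveCurve k}
  {X₀ : SmoothProjectiveCurve k₀} {π : X.carrier ⟶ X₀.carrier}

/-- Pullback of functions along `π`, from the local ring of `X₀` at the image of the generic point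
of `X` to the function field of `X`. -/
def genericPullback (π : X.carrier ⟶ X₀.carrier) :
    X₀.carrier.presheaf.stalk (π (genericPoint X.carrier)) →+* X.Mero :=
  (π.stalkMap (genericPoint X.carrier)).hom

theorem nonempty_preimage_iff {U : X₀.carrier.Opens} :
    Nonempty (π ⁻¹ᵁ U) ↔ π (genericPoint X.carrier) ∈ U := by
  refine ⟨fun h ↦ ?_, fun h ↦ ⟨⟨_, h⟩⟩⟩
  exact ((genericPoint_spec X.carrier).mem_open_set_iff (π ⁻¹ᵁ U).isOpen).mpr (by simpa using h)

theorem genericPullback_germ {U : X₀.carrier.Opens} [Nonempty (π ⁻¹ᵁ U)]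
    (h : π (genericPoint X.carrier) ∈ U) (s : Γ(X₀.carrier, U)) :
    genericPullback π (X₀.carrier.presheaf.germ U _ h s) =
      X.carrier.germToFunctionField (π ⁻¹ᵁ U) (π.app U s) :=
  π.germ_stalkMap_apply U (genericPoint X.carrier) h s

theorem isPullbackFunction_iff {f : X.Mero} :
    IsPullbackFunction π f ↔ ∃ s, genericPullback π s = f := by
  constructor
  · rintro ⟨U, hU, s, rfl⟩
    exact ⟨_, genericPullback_germ (nonempty_preimage_iff.mp hU) s⟩
  · rintro ⟨s, rfl⟩
    obtain ⟨U, hU, s, rfl⟩ := X₀.carrier.presheaf.exists_germ_eq s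
    have := nonempty_preimage_iff.mpr hU
    exact ⟨U, this, s, (genericPullback_germ hU s).symm⟩

theorem IsPullbackFunction.div {f g : X.Mero} (hf : IsPullbackFunction π f)
    (hg : IsPullbackFunction π g) : IsPullbackFunction π (f / g) := by
  rw [isPullbackFunction_iff] at *
  obtain ⟨s, rfl⟩ := hf
  obtain ⟨t, rfl⟩ := hg
  by_cases ht : genericPullback π t = 0
  · exact ⟨0, by rw [ht, div_zero, map_zero]⟩
  · have : IsLocalHom (genericPullback π) :=
      inferInstanceAs (IsLocalHom (π.stalkMap (genericPoint X.carrier)).hom)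
    obtain ⟨u, hu⟩ := isUnit_of_map_unit (genericPullback π) t (Ne.isUnit ht)
    refine ⟨s * ↑u⁻¹, ?_⟩
    rw [eq_div_iff ht, ← map_mul, ← hu, mul_assoc, Units.inv_mul, mul_one]

theorem genericPullback_constStalk (hπ : IsModel ι X X₀ π) (c : k₀) :
    genericPullback π (X₀.constStalk _ c) = algebraMap k X.Mero (ι c) := by
  have h1 := π.germ_stalkMap_apply ⊤ (genericPoint X.carrier) trivial
    (X₀.str.appTop ((Scheme.ΓSpecIso (.of k₀)).inv c))
  refine h1.trans ?_
  change X.carrier.presheaf.germ ⊤ _ _ (π.appTop (X₀.str.appTop _)) =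
    X.carrier.presheaf.germ ⊤ _ _ (X.str.appTop ((Scheme.ΓSpecIso (.of k)).inv (ι c)))
  congr 1
  have h2 : X₀.str.appTop ≫ π.appTop =
      (Spec.map (CommRingCat.ofHom ι)).appTop ≫ X.str.appTop := by
    rw [← Scheme.Hom.comp_appTop, ← Scheme.Hom.comp_appTop, hπ.w]
  have h3 := Scheme.ΓSpecIso_inv_naturality (CommRingCat.ofHom ι)
  have h4 := ConcreteCategory.congr_hom h2 ((Scheme.ΓSpecIso (.of k₀)).inv c)
  have h5 := ConcreteCategory.congr_hom h3 c
  simp only [ConcreteCategory.comp_apply] at h4 h5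
  rw [h4, ← h5]
  rfl

open Polynomial in
theorem IsPullbackFunction.aeval_map (hπ : IsModel ι X X₀ π) {f : X.Mero}
    (hf : IsPullbackFunction π f) (P : k₀[X]) :
    IsPullbackFunction π (aeval f (P.map ι)) := by
  rw [isPullbackFunction_iff] at *
  obtain ⟨s, rfl⟩ := hf
  refine ⟨eval₂ (X₀.constStalk _) s P, ?_⟩
  rw [hom_eval₂, aeval_def, eval₂_map]
  congr 1
  ext c
  exact genericPullback_constStalk hπ c

open scoped TensorProduct in
/-- The coordinate ring of an affine open subset of `X₀` generates the function field of `X`, linear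
independence over `k₀` of its elements is preserved, and the functions defined over `k₀` are the
fractions of its elements. -/
theorem exists_coordinateRing [Algebra k₀ k] [Algebra k₀ X.Mero] [IsScalarTower k₀ k X.Mero]
    (hπ : IsModel (algebraMap k₀ k) X X₀ π) :
    ∃ (A : Type) (_ : CommRing A) (_ : Algebra k₀ A) (ψ : A →ₐ[k₀] X.Mero),
      (∀ (ι : Type) (v : ι → A), LinearIndependent k₀ v → LinearIndependent k (ψ ∘ v)) ∧
      IntermediateField.adjoin k (Set.range ψ) = ⊤ ∧
      ∀ f, IsPullbackFunction π f → ∃ a b, ψ b ≠ 0 ∧ f = ψ a / ψ b := by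
  obtain ⟨_, ⟨U, hU, rfl⟩, hyU, -⟩ := X₀.carrier.isBasis_affineOpens.exists_subset_of_mem_open
    (Set.mem_univ (π (genericPoint X.carrier))) isOpen_univ
  have hU : IsAffineOpen U := hU
  have hyU : π (genericPoint X.carrier) ∈ U := hyU
  have hne : Nonempty (π ⁻¹ᵁ U) := nonempty_preimage_iff.mpr hyU
  have hpush₀ := (isIso_pushoutSection_iff hπ (US := ⊤) (UT := ⊤) (UX := U) (UY := π ⁻¹ᵁ U)
    le_top le_top (by simp)).mp (isIso_pushoutSection_of_isAffineOpen hπ _ _ _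
      (isAffineOpen_top _) (isAffineOpen_top _) hU)
  have hpush : IsPushout ((Scheme.ΓSpecIso (.of k₀)).inv ≫ X₀.str.appLE ⊤ U le_top)
      (CommRingCat.ofHom (algebraMap k₀ k)) (π.app U)
      ((Scheme.ΓSpecIso (.of k)).inv ≫ X.str.appLE ⊤ (π ⁻¹ᵁ U) le_top) := by
    refine hpush₀.of_iso (Scheme.ΓSpecIso (.of k₀)) (Iso.refl _) (Scheme.ΓSpecIso (.of k))
      (Iso.refl _) ?_ ?_ ?_ ?_
    · simp
    · refine Eq.trans ?_ (Scheme.ΓSpecIso_naturality (CommRingCat.ofHom (algebraMap k₀ k)))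
      congr 1
    · simp [Scheme.Hom.appLE]
    · simp
  have : IsAffineHom π :=
    MorphismProperty.of_isPullback (P := @IsAffineHom) hπ.flip inferInstance
  have hfrac : IsFractionRing Γ(X.carrier, π ⁻¹ᵁ U) X.Mero :=
    functionField_isFractionRing_of_isAffineOpen _ _ (hU.preimage π)
  let : Algebra k₀ Γ(X₀.carrier, U) :=
    ((Scheme.ΓSpecIso (.of k₀)).inv ≫ X₀.str.appLE ⊤ U le_top).hom.toAlgebra
  let : Algebra k Γ(X.carrier, π ⁻¹ᵁ U) :=
    ((Scheme.ΓSpecIso (.of k)).inv ≫ X.str.appLE ⊤ (π ⁻¹ᵁ U) le_top).hom.toAlgebra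
  let : Algebra Γ(X₀.carrier, U) Γ(X.carrier, π ⁻¹ᵁ U) := (π.app U).hom.toAlgebra
  let : Algebra k₀ Γ(X.carrier, π ⁻¹ᵁ U) := ((algebraMap Γ(X₀.carrier, U)
    Γ(X.carrier, π ⁻¹ᵁ U)).comp (algebraMap k₀ Γ(X₀.carrier, U))).toAlgebra
  have : IsScalarTower k₀ Γ(X₀.carrier, U) Γ(X.carrier, π ⁻¹ᵁ U) := .of_algebraMap_eq fun _ ↦ rfl
  have : IsScalarTower k₀ k Γ(X.carrier, π ⁻¹ᵁ U) :=
    .of_algebraMap_eq fun c ↦ ConcreteCategory.congr_hom hpush.w c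
  have hbase : IsBaseChange k (IsScalarTower.toAlgHom k₀ Γ(X₀.carrier, U)
      Γ(X.carrier, π ⁻¹ᵁ U)).toLinearMap :=
    ((CommRingCat.isPushout_iff_isPushout (R := k₀) (R' := Γ(X₀.carrier, U)) (S := k)
      (S' := Γ(X.carrier, π ⁻¹ᵁ U))).mp hpush).symm.out
  have htower : IsScalarTower k Γ(X.carrier, π ⁻¹ᵁ U) X.Mero := .of_algebraMap_eq fun c ↦ by
    refine (X.carrier.presheaf.germ_res_apply (homOfLE (le_top : π ⁻¹ᵁ U ≤ ⊤))
      (genericPoint X.carrier) hyU _).symm.trans ?_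
    rfl
  let ψ : Γ(X₀.carrier, U) →ₐ[k₀] X.Mero :=
    { (algebraMap Γ(X.carrier, π ⁻¹ᵁ U) X.Mero).comp
        (algebraMap Γ(X₀.carrier, U) Γ(X.carrier, π ⁻¹ᵁ U)) with
      commutes' c := by
        change algebraMap Γ(X.carrier, π ⁻¹ᵁ U) X.Mero (algebraMap k₀ Γ(X.carrier, π ⁻¹ᵁ U) c) = _
        rw [IsScalarTower.algebraMap_apply k₀ k Γ(X.carrier, π ⁻¹ᵁ U),
          ← IsScalarTower.algebraMap_apply k, ← IsScalarTower.algebraMap_apply k₀] }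
  have hψ (a : Γ(X₀.carrier, U)) :
      ψ a = genericPullback π (X₀.carrier.presheaf.germ U _ hyU a) :=
    (genericPullback_germ hyU a).symm
  refine ⟨Γ(X₀.carrier, U), inferInstance, inferInstance, ψ, fun J v hv ↦ ?_, ?_, fun f hf ↦ ?_⟩
  · have h1 := (Module.Flat.linearIndependent_one_tmul (S := k) hv).map' hbase.equiv.toLinearMap
      (LinearEquiv.ker _)
    have h2 := h1.map' (IsScalarTower.toAlgHom k Γ(X.carrier, π ⁻¹ᵁ U) X.Mero).toLinearMap
      (LinearMap.ker_eq_bot.mpr (IsFractionRing.injective _ _))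
    have h3 : ψ ∘ v = (IsScalarTower.toAlgHom k Γ(X.carrier, π ⁻¹ᵁ U) X.Mero).toLinearMap ∘
        hbase.equiv.toLinearMap ∘ fun j ↦ 1 ⊗ₜ[k₀] v j := by
      ext j
      simp only [Function.comp_apply, LinearEquiv.coe_coe, IsBaseChange.equiv_tmul, one_smul]
      rfl
    rw [h3]
    exact h2
  · have hP (x : Γ(X.carrier, π ⁻¹ᵁ U)) :
        algebraMap _ X.Mero x ∈ IntermediateField.adjoin k (Set.range ψ) := by
      induction x using hbase.inductionOn with
      | zero => rw [map_zero]; exact zero_mem _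
      | tmul a => exact IntermediateField.subset_adjoin _ _ ⟨a, rfl⟩
      | smul c x hx =>
        rw [Algebra.smul_def, map_mul, ← IsScalarTower.algebraMap_apply]
        exact mul_mem (IntermediateField.algebraMap_mem _ c) hx
      | add x y hx hy =>
        rw [map_add]
        exact add_mem hx hy
    rw [eq_top_iff]
    intro z _
    obtain ⟨x, y, -, rfl⟩ := IsFractionRing.div_surjective (A := Γ(X.carrier, π ⁻¹ᵁ U)) z
    exact div_mem (hP x) (hP y)
  · obtain ⟨s, rfl⟩ := isPullbackFunction_iff.mp hf
    let := TopCat.Presheaf.algebra_section_stalk X₀.carrier.presheaf (U := U) ⟨_, hyU⟩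
    have hloc : IsLocalization.AtPrime
        (X₀.carrier.presheaf.stalk (π (genericPoint X.carrier)))
        (hU.primeIdealOf ⟨_, hyU⟩).asIdeal := hU.isLocalization_stalk ⟨_, hyU⟩
    obtain ⟨a, b, rfl⟩ := IsLocalization.exists_mk'_eq
      (hU.primeIdealOf ⟨_, hyU⟩).asIdeal.primeCompl s
    have hb : IsUnit (algebraMap Γ(X₀.carrier, U)
        (X₀.carrier.presheaf.stalk (π (genericPoint X.carrier))) b) :=
      IsLocalization.map_units _ b
    have hb0 : ψ b ≠ 0 := by
      rw [hψ]
      exact (hb.map (genericPullback π)).ne_zero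
    refine ⟨a, b, hb0, ?_⟩
    rw [eq_div_iff hb0, hψ, hψ]
    refine (map_mul _ _ _).symm.trans (congrArg _ ?_)
    exact IsLocalization.mk'_spec _ a b

end SmoothProjectiveCurve

end Model

/-! ### Composition with rational functions -/

section Composition

open Polynomial IsLocalRing

namespace SmoothProjectiveCurve

variable {k : Type} [Field k] {X : SmoothProjectiveCurve k}

theorem coe_mem_branchLocus_iff {f : X.Mero} {c : k} :
    (c : OnePoint k) ∈ branchLocus f ↔
      ∃ x : X.carrier, IsClosed {x} ∧ VanishesDoublyAt (f - algebraMap k X.Mero c) x := by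
  constructor
  · rintro ⟨x, hx, ⟨d, hd, h⟩ | ⟨h, -⟩⟩
    · rw [OnePoint.coe_injective hd]
      exact ⟨x, hx, h⟩
    · exact absurd h (OnePoint.coe_ne_infty c)
  · rintro ⟨x, hx, h⟩
    exact ⟨x, hx, .inl ⟨c, rfl, h⟩⟩

theorem coe_mem_branchLocus_of_mem_sq {f : X.Mero} {c : k} {x : X.carrier} (hx : IsClosed {x})
    {r : X.carrier.presheaf.stalk x} (hr : f = algebraMap (X.carrier.presheaf.stalk x) X.Mero r)
    (h : r - algebraMap k (X.carrier.presheaf.stalk x) c ∈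
      maximalIdeal (X.carrier.presheaf.stalk x) ^ 2) :
    (c : OnePoint k) ∈ branchLocus f := by
  refine coe_mem_branchLocus_iff.mpr ⟨x, hx, _, h, ?_⟩
  rw [map_sub, ← IsScalarTower.algebraMap_apply, hr]

theorem isNonconstant_of_transcendental {f : X.Mero} (hf : Transcendental k f) :
    IsNonconstant f := by
  rintro c rfl
  exact hf (isAlgebraic_algebraMap c)

variable [IsAlgClosed k]

theorem IsNonconstant.transcendental {f : X.Mero} (hf : IsNonconstant f) : Transcendental k f :=
  transcendental_of_forall_ne_algebraMap hf

/-- The finite branch points of a function defined over `k₀` are roots of a nonzero polynomial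
over `k₀`. -/
theorem exists_aeval_eq_zero_of_mem_branchLocus {k₀ : Type} [Field k₀] [CharZero k₀]
    {X₀ : SmoothProjectiveCurve k₀} {π : X.carrier ⟶ X₀.carrier} [Algebra k₀ k]
    (hπ : IsModel (algebraMap k₀ k) X X₀ π) {f : X.Mero} (hpb : IsPullbackFunction π f)
    (hf : IsNonconstant f) (hdeg : degree f ≠ 0) :
    ∃ D : k₀[X], D ≠ 0 ∧ ∀ c : k, (c : OnePoint k) ∈ branchLocus f → aeval c D = 0 := by
  let : Algebra k₀ X.Mero := ((algebraMap k X.Mero).comp (algebraMap k₀ k)).toAlgebra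
  have : IsScalarTower k₀ k X.Mero := .of_algebraMap_eq fun _ ↦ rfl
  obtain ⟨A, _, _, ψ, hψ, hgen, hfracs⟩ := exists_coordinateRing hπ
  obtain ⟨a, b, hb, hfab⟩ := hfracs f hpb
  have : FiniteDimensional (IntermediateField.adjoin k {f}) X.Mero :=
    FiniteDimensional.of_finrank_pos (Nat.pos_of_ne_zero hdeg)
  obtain ⟨D, hD, hbranch⟩ :=
    exists_aeval_eq_zero_of_branch_value ψ hψ hgen hf.transcendental hb hfab
  refine ⟨D, hD, fun c hc ↦ ?_⟩
  obtain ⟨x, hx, hvan⟩ := coe_mem_branchLocus_iff.mp hc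
  have := X.isDiscreteValuationRing_stalk hx (sub_ne_zero.mpr (hf c)) hvan
  obtain ⟨e, he, hfe⟩ := hvan
  refine hbranch (X.carrier.presheaf.stalk x) (X.stalk_of_isClosed hx).2.2
    (e + algebraMap k (X.carrier.presheaf.stalk x) c) c ?_ (by simpa using he)
  rw [map_add, hfe, ← IsScalarTower.algebraMap_apply, sub_add_cancel]

/-- The finite branch points of `P(f)` are values of `P` at branch points of `f` or at critical
points of `P`. -/
theorem exists_of_mem_branchLocus_aeval {f : X.Mero} (hf : IsNonconstant f) {P : k[X]}
    (hP : P.natDegree ≠ 0) {c : k} (hc : (c : OnePoint k) ∈ branchLocus (aeval f P)) :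
    ∃ b : k, P.eval b = c ∧
      ((derivative P).eval b = 0 ∨ (b : OnePoint k) ∈ branchLocus f) := by
  obtain ⟨x, hx, hvan⟩ := coe_mem_branchLocus_iff.mp hc
  have hne : aeval f P - algebraMap k X.Mero c ≠ 0 := by
    intro h
    refine aeval_ne_zero_of_transcendental hf.transcendental (P := P - C c) ?_ (by simpa using h)
    intro h
    rw [sub_eq_zero.mp h] at hP
    simp at hP
  have := X.isDiscreteValuationRing_stalk hx hne hvan
  obtain ⟨e, he, hfe⟩ := hvan
  obtain ⟨r, b, hr, hb, h⟩ :=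
    exists_of_aeval_sub_mem_sq (X.stalk_of_isClosed hx).2.2 hP he hfe.symm
  exact ⟨b, hb, h.imp_right (coe_mem_branchLocus_of_mem_sq hx hr)⟩

/-- If the finite branch points of `f` are zeros or poles of `A / B`, and the only other possible
critical point of `A / B` is `∞`, where the value is `1`, then `A(f) / B(f)` is a Belyi
function. -/
theorem isBelyi_div {f : X.Mero} (hf : IsNonconstant f) {A B : k[X]} (hA : A.Monic) (hB : B.Monic)
    (hdeg : A.natDegree = B.natDegree) (hA0 : A.natDegree ≠ 0) (hAB : IsCoprime A B)
    (hcrit : ∀ b : k, A.eval b ≠ 0 → B.eval b ≠ 0 →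
        (derivative A).eval b * B.eval b ≠ A.eval b * (derivative B).eval b)
    (hbranch : ∀ b : k, (b : OnePoint k) ∈ branchLocus f → A.eval b = 0 ∨ B.eval b = 0) :
    IsBelyi (aeval f A / aeval f B) := by
  have hft := hf.transcendental
  have hBf : aeval f B ≠ 0 := aeval_ne_zero_of_transcendental hft hB.ne_zero
  have hnc : IsNonconstant (aeval f A / aeval f B) := by
    intro c hc
    rw [div_eq_iff hBf] at hc
    have hABc : A = C c * B := by
      by_contra h
      refine aeval_ne_zero_of_transcendental hft (P := A - C c * B) (sub_ne_zero.mpr h) ?_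
      rw [map_sub, map_mul, aeval_C, hc, sub_self]
    have hu : IsUnit B := hAB.isUnit_of_dvd' (hABc ▸ dvd_mul_left B (C c)) dvd_rfl
    exact hA0 (hdeg.trans (natDegree_eq_zero_of_isUnit hu))
  refine ⟨hnc, fun p hp ↦ ?_⟩
  induction p using OnePoint.rec with
  | infty => simp
  | coe c =>
    by_contra hc
    have hc0 : c ≠ 0 := by
      rintro rfl
      exact hc (by simp)
    have hc1 : c ≠ 1 := by
      rintro rfl
      exact hc (by simp)
    obtain ⟨x, hx, hvan⟩ := coe_mem_branchLocus_iff.mp hp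
    have := X.isDiscreteValuationRing_stalk hx (sub_ne_zero.mpr (hnc c)) hvan
    obtain ⟨e, he, hfe⟩ := hvan
    obtain ⟨r, b, hr, hbA, hbB, h⟩ := exists_of_div_sub_mem_sq (X.stalk_of_isClosed hx).2.2 hft hA
      hB hdeg hAB hcrit hc0 hc1 he hfe.symm
    exact (hbranch b (coe_mem_branchLocus_of_mem_sq hx hr h)).elim hbA hbB

end SmoothProjectiveCurve

end Composition

end

open Polynomial in
theorem mainTheorem6 (ι : AlgebraicClosure ℚ →+* ℂ)
    (X : SmoothProjectiveCurve ℂ) (X₀ : SmoothProjectiveCurve (AlgebraicClosure ℚ))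
    (π : X.carrier ⟶ X₀.carrier) (hπ : SmoothProjectiveCurve.IsModel ι X X₀ π)
    (hf : ∃ f : X.Mero, SmoothProjectiveCurve.IsPullbackFunction π f ∧
      SmoothProjectiveCurve.IsNonconstant f ∧ Odd (SmoothProjectiveCurve.degree f)) :
    ∃ φ : X.Mero, SmoothProjectiveCurve.IsBelyi φ ∧ Odd (SmoothProjectiveCurve.degree φ) ∧
      SmoothProjectiveCurve.IsPullbackFunction π φ := by
  obtain ⟨f, hpb, hnc, hodd⟩ := hf
  let : Algebra (AlgebraicClosure ℚ) ℂ := ι.toAlgebra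
  obtain ⟨D, hD, hbranch⟩ :=
    SmoothProjectiveCurve.exists_aeval_eq_zero_of_mem_branchLocus hπ hpb hnc
      (fun h ↦ by simp [h] at hodd)
  -- `ℚ`-algebra structures are unique, but the instance found here is not the one for which the
  -- algebraic closure is known to be algebraic
  have : Algebra.IsAlgebraic ℚ (AlgebraicClosure ℚ) := by
    rw [Subsingleton.elim (DivisionRing.toRatAlgebra : Algebra ℚ (AlgebraicClosure ℚ))
      (AlgebraicClosure.instAlgebra ℚ)]
    exact AlgebraicClosure.isAlgebraic ℚ
  -- the first composite, whose finite branch points are integers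
  obtain ⟨P, S, hPodd, hS, hPS⟩ := exists_odd_natDegree_integer_values hD
  have hP0 : P.natDegree ≠ 0 := fun h ↦ by simp [h] at hPodd
  have hPd : derivative P ≠ 0 := fun h ↦ hP0 (derivative_eq_zero.mp h)
  have hPι : (P.map ι).natDegree = P.natDegree := natDegree_map ι
  set g : X.Mero := aeval f (P.map ι) with hg
  have hgt : Transcendental ℂ g := hnc.transcendental.aeval _ (by rwa [hPι])
    (mem_nonZeroDivisors_of_ne_zero (leadingCoeff_ne_zero.mpr fun h ↦ by
      rw [h, natDegree_zero] at hPι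
      exact hP0 hPι.symm))
  have hgnc := SmoothProjectiveCurve.isNonconstant_of_transcendental hgt
  have hgdeg : Odd (SmoothProjectiveCurve.degree g) := by
    have := finrank_adjoin_div hnc.transcendental (A := P.map ι) one_ne_zero isCoprime_one_right
      (by simp)
    rw [map_one, div_one] at this
    rw [SmoothProjectiveCurve.degree, this, hPι]
    exact hPodd.mul hodd
  have hgbranch : ∀ c : ℂ, (c : OnePoint ℂ) ∈ SmoothProjectiveCurve.branchLocus g →
      ∃ s ∈ S, c = (s : ℂ) := by
    intro c hc
    obtain ⟨b, rfl, hb⟩ := SmoothProjectiveCurve.exists_of_mem_branchLocus_aeval hnc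
      (by rwa [hPι]) hc
    have hb' : aeval b D = 0 ∨ aeval b (derivative P) = 0 := by
      refine hb.symm.imp (hbranch b) fun h ↦ ?_
      rwa [derivative_map, Polynomial.eval_map] at h
    -- the point `b` is algebraic over `ℚ`
    obtain ⟨b₀, rfl⟩ : ∃ b₀, ι b₀ = b := by
      by_contra! h
      have ht := transcendental_of_forall_ne_algebraMap (k := AlgebraicClosure ℚ) (f := b)
        fun c hc ↦ h c hc.symm
      exact hb'.elim (aeval_ne_zero_of_transcendental ht hD)
        (aeval_ne_zero_of_transcendental ht hPd)
    have heval (Q : (AlgebraicClosure ℚ)[X]) : aeval (ι b₀) Q = ι (Q.eval b₀) :=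
      aeval_algebraMap_apply ℂ b₀ Q
    rw [heval, heval, map_eq_zero, map_eq_zero] at hb'
    obtain ⟨s, hs, hPs⟩ := hPS b₀ hb'
    exact ⟨s, hs, by rw [eval_map_apply, hPs, map_intCast]⟩
  -- the second composite
  obtain ⟨A, B, hA, hB, hAodd, hdeg, hAB, hABS, hcrit⟩ :=
    exists_fraction_of_odd_degree (K := AlgebraicClosure ℚ) (E := ℂ) S hS
  have heval (Q : (AlgebraicClosure ℚ)[X]) (b : ℂ) : (Q.map ι).eval b = aeval b Q :=
    eval_map_algebraMap Q b
  have hABι : IsCoprime (A.map ι) (B.map ι) := hAB.map (mapRingHom ι)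
  have hdegι : (A.map ι).natDegree = (B.map ι).natDegree := by
    rw [natDegree_map, natDegree_map, hdeg]
  refine ⟨aeval g (A.map ι) / aeval g (B.map ι), ?_, ?_, ?_⟩
  · refine SmoothProjectiveCurve.isBelyi_div hgnc (hA.map ι) (hB.map ι) hdegι ?_ hABι ?_ ?_
    · rw [natDegree_map]
      intro h
      simp [h] at hAodd
    · simpa only [derivative_map, heval] using hcrit
    · intro b hb
      obtain ⟨s, hs, rfl⟩ := hgbranch b hb
      simpa only [heval] using hABS s hs
  · rw [SmoothProjectiveCurve.degree,
      finrank_adjoin_div hgt (hB.map ι).ne_zero hABι hdegι.ge, natDegree_map]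
    exact hAodd.mul hgdeg
  · exact ((hpb.aeval_map hπ P).aeval_map hπ A).div ((hpb.aeval_map hπ P).aeval_map hπ B)
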